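/- Let $W$ (women) and $M$ (men) be finite sets with $|W|=|M|=n$. A preference list of a woman is a totally ordered subset of $M$, and her blacklist is the set of men not on her list; preference lists and blacklists of men are defined symmetrically, and a profile for a side consists of one preference list for each of its members. A matching is a one-to-one mapping between a subset of $W$ and a subset of $M$; it is perfect if everybody is matched. It is $M$-rational (resp. $W$-rational) if no man (resp. no woman) is matched with somebody from his (her) blacklist. It is stable if it is $W$-rational and $M$-rational and there are no woman $w$ and man $m$ who do not blacklist each other and each of whom is either unmatched or prefers the other over the assigned partner. **Theorem.** For every profile $\mathcal P_M$ of preference lists for $M$ and every $M$-rational perfect matching $\mu$ there is a profile $\mathcal P_W$ of preference lists for $W$ such that 1. $\mu$ is the only stable matching with respect to $\mathcal P_W$ and $\mathcal P_M$; 2. the blacklists in $\mathcal P_W$ are pairwise disjoint; 3. the number $n_b$ of women with a nonempty blacklist in $\mathcal P_W$ is at most $\lfloor n/2\rfloor$; 4. the combined size $\sum_{w\in W}|B_w|$ of all blacklists $B_w$ in $\mathcal P_W$ is at most $n-n_b$. Furthermore, there is a single algorithm (a program of a random access machine with unit costs, given $n$, the lists of $\mathcal P_M$ and $\mu$ in arrays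 and writing the lists of $\mathcal P_W$ into an array) that computes such a profile $\mathcal P_W$ from $\mathcal P_M$ and $\mu$ * in worst-case time $O(n^3)$; * in best-case time $O(n^2)$, this bound holding on all inputs in which the top choices of the men are pairwise distinct; * in average-case time $O(n^2\log n)$ (for $n\ge 2$): for every $\mathcal P_M$ that admits an $M$-rational perfect matching, this bounds the mean running time when $\mu$ is uniformly distributed over the $M$-rational perfect matchings. The implied constants are absolute. -/

import Mathlib

universe u v

/-! ## Two-sided matching markets -/

/-- A preference list over a finite set `α`: a totally ordered subset of `α`, written as a
duplicate-free list, most preferred member first. -/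
structure PrefList (α : Type*) where
  toList : List α
  nodup : toList.Nodup

namespace PrefList

/-- `a` and `b` are both on the list, and `a` is strictly before `b`. -/
def Prefers {α : Type*} (L : PrefList α) (a b : α) : Prop := [a, b].Sublist L.toList

/-- The blacklist: everybody who is not on the list. -/
def blacklist {α : Type*} (L : PrefList α) : Set α := {a | a ∉ L.toList}

end PrefList

/-- A profile of preference lists for the side `A`, over the other side `B`. -/
abbrev Profile (A B : Type*) := A → PrefList B

/-- The number of participants of the side `A` that have a nonempty blacklist. -/
noncomputable def numNonemptyBlacklists {A B : Type*} (P : Profile A B) : ℕ :=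
  {a | (P a).blacklist.Nonempty}.ncard

/-- The combined size of all blacklists in a profile. -/
noncomputable def combinedBlacklistSize {A B : Type*} [Fintype A] (P : Profile A B) : ℕ :=
  ∑ a, (P a).blacklist.ncard

/-- A (possibly partial) matching: a bijection between a subset of `W` and a subset of `M`. Here
`μ w : Option M` is the partner of `w`, if any, and `μ.symm m : Option W` that of `m`. A perfect
matching is a bijection `W ≃ M`, seen as a matching through `Equiv.toPEquiv`. -/
abbrev Matching (W M : Type*) := W ≃. M

/-- No woman is matched with a man from her blacklist. -/
def IsWRational {W M : Type*} (PW : Profile W M) (μ : Matching W M) : Prop :=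
  ∀ w m, μ w = some m → m ∉ (PW w).blacklist

/-- No man is matched with a woman from his blacklist. -/
def IsMRational {W M : Type*} (PM : Profile M W) (μ : Matching W M) : Prop :=
  ∀ m w, μ.symm m = some w → w ∉ (PM m).blacklist

/-- `w` and `m` do not blacklist each other, and each of them is either unmatched or prefers the
other over the partner assigned by `μ`. -/
def IsBlockingPair {W M : Type*} (PW : Profile W M) (PM : Profile M W) (μ : Matching W M)
    (w : W) (m : M) : Prop :=
  m ∉ (PW w).blacklist ∧ w ∉ (PM m).blacklist ∧
    (μ w = none ∨ ∃ m', μ w = some m' ∧ (PW w).Prefers m m') ∧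
    (μ.symm m = none ∨ ∃ w', μ.symm m = some w' ∧ (PM m).Prefers w w')

/-- Stability of a matching. -/
def IsStable {W M : Type*} (PW : Profile W M) (PM : Profile M W) (μ : Matching W M) : Prop :=
  IsWRational PW μ ∧ IsMRational PM μ ∧ ∀ w m, ¬ IsBlockingPair PW PM μ w m

/-- The women's profile `PW` forces the perfect matching `μ` against the men's profile `PM`, with
small blacklists. -/
structure ForcesInconspicuously {W M : Type*} [Fintype W] (PM : Profile M W) (μ : W ≃ M)
    (PW : Profile W M) : Prop where
  /-- `μ` is the only stable matching. -/
  unique_stable : ∀ ν : Matching W M, IsStable PW PM ν ↔ ν = μ.toPEquiv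
  /-- No man is in more than one blacklist. -/
  disjoint_blacklists : ∀ w w', w ≠ w' → Disjoint (PW w).blacklist (PW w').blacklist
  /-- At most `⌊n / 2⌋` women have nonempty blacklists. -/
  numNonempty_le : numNonemptyBlacklists PW ≤ Fintype.card W / 2
  /-- The combined size of the blacklists plus the number of nonempty ones is at most `n`. -/
  combinedSize_le : combinedBlacklistSize PW + numNonemptyBlacklists PW ≤ Fintype.card W

/-! ## A random access machine with unit costs

The machine has registers and (initially blank) two-dimensional arrays, both holding natural
numbers. A program names finitely many registers and arrays. The only arithmetic is adding or
subtracting one, so that no number exceeds the largest number in the input and the program by more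
than the number of steps, and unit costs are realistic. -/

/-- Contents of the registers, and of the cells `(i, j)` of the arrays. -/
structure RAMState where
  reg : ℕ → ℕ
  arr : ℕ → ℕ → ℕ → ℕ

/-- Write a register. -/
def RAMState.setReg (s : RAMState) (x v : ℕ) : RAMState :=
  { s with reg := Function.update s.reg x v }

/-- Write the cell `(i, j)` of the array `a`. -/
def RAMState.setArr (s : RAMState) (a i j v : ℕ) : RAMState :=
  { s with arr := fun a' i' j' => if a' = a ∧ i' = i ∧ j' = j then v else s.arr a' i' j' }

/-- Programs. The arguments `x y i j` are names of registers, `a` is the name of an array. -/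
inductive RAMProgram where
  | skip
  /-- `x := k` for a literal `k` -/
  | const (x k : ℕ)
  /-- `x := y` -/
  | copy (x y : ℕ)
  /-- `x := y + 1` -/
  | succ (x y : ℕ)
  /-- `x := y - 1`, or `0` if `y = 0` -/
  | pred (x y : ℕ)
  /-- `x := a[i, j]` -/
  | load (x a i j : ℕ)
  /-- `a[i, j] := x` -/
  | store (a i j x : ℕ)
  | seq (p q : RAMProgram)
  /-- `if x < y then p else q` -/
  | ifLT (x y : ℕ) (p q : RAMProgram)
  /-- `while x < y do p` -/
  | whileLT (x y : ℕ) (p : RAMProgram)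

/-- `Exec p s t s'`: started in the state `s`, the program `p` halts after exactly `t` steps, in
the state `s'`. Every elementary instruction and every evaluated test is one step. -/
inductive RAMProgram.Exec : RAMProgram → RAMState → ℕ → RAMState → Prop
  | skip (s : RAMState) : Exec .skip s 1 s
  | const (s : RAMState) (x k : ℕ) : Exec (.const x k) s 1 (s.setReg x k)
  | copy (s : RAMState) (x y : ℕ) : Exec (.copy x y) s 1 (s.setReg x (s.reg y))
  | succ (s : RAMState) (x y : ℕ) : Exec (.succ x y) s 1 (s.setReg x (s.reg y + 1))
  | pred (s : RAMState) (x y : ℕ) : Exec (.pred x y) s 1 (s.setReg x (s.reg y - 1))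
  | load (s : RAMState) (x a i j : ℕ) :
      Exec (.load x a i j) s 1 (s.setReg x (s.arr a (s.reg i) (s.reg j)))
  | store (s : RAMState) (a i j x : ℕ) :
      Exec (.store a i j x) s 1 (s.setArr a (s.reg i) (s.reg j) (s.reg x))
  | seq {p q : RAMProgram} {s s' s'' : RAMState} {t t' : ℕ} :
      Exec p s t s' → Exec q s' t' s'' → Exec (.seq p q) s (t + t') s''
  | ifTrue {x y : ℕ} {p q : RAMProgram} {s s' : RAMState} {t : ℕ} :
      s.reg x < s.reg y → Exec p s t s' → Exec (.ifLT x y p q) s (t + 1) s'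
  | ifFalse {x y : ℕ} {p q : RAMProgram} {s s' : RAMState} {t : ℕ} :
      ¬ s.reg x < s.reg y → Exec q s t s' → Exec (.ifLT x y p q) s (t + 1) s'
  | whileTrue {x y : ℕ} {p : RAMProgram} {s s' s'' : RAMState} {t t' : ℕ} :
      s.reg x < s.reg y → Exec p s t s' → Exec (.whileLT x y p) s' t' s'' →
      Exec (.whileLT x y p) s (t + t' + 1) s''
  | whileFalse {x y : ℕ} {p : RAMProgram} {s : RAMState} :
      ¬ s.reg x < s.reg y → Exec (.whileLT x y p) s 1 s

/-- Programs are deterministic; in particular the number of steps is a function of the input. -/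
theorem RAMProgram.Exec.deterministic {p : RAMProgram} {s s₁ s₂ : RAMState} {t₁ t₂ : ℕ}
    (h₁ : p.Exec s t₁ s₁) (h₂ : p.Exec s t₂ s₂) : t₁ = t₂ ∧ s₁ = s₂ := by
  induction h₁ generalizing t₂ s₂ with
  | seq _ _ ih ih' =>
    cases h₂ with
    | seq a b =>
      obtain ⟨rfl, rfl⟩ := ih a
      obtain ⟨rfl, rfl⟩ := ih' b
      exact ⟨rfl, rfl⟩
  | ifTrue h _ ih =>
    cases h₂ with
    | ifTrue _ a => obtain ⟨rfl, rfl⟩ := ih a; exact ⟨rfl, rfl⟩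
    | ifFalse h' _ => exact absurd h h'
  | ifFalse h _ ih =>
    cases h₂ with
    | ifTrue h' _ => exact absurd h' h
    | ifFalse _ a => obtain ⟨rfl, rfl⟩ := ih a; exact ⟨rfl, rfl⟩
  | whileTrue h _ _ ih ih' =>
    cases h₂ with
    | whileTrue _ a b =>
      obtain ⟨rfl, rfl⟩ := ih a
      obtain ⟨rfl, rfl⟩ := ih' b
      exact ⟨rfl, rfl⟩
    | whileFalse h' => exact absurd h h'
  | whileFalse h =>
    cases h₂ with
    | whileTrue h' _ _ => exact absurd h' h
    | whileFalse _ => exact ⟨rfl, rfl⟩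
  | _ => cases h₂; exact ⟨rfl, rfl⟩

/-! ## Input, output, running times -/

/-- The initial state for the men's profile `PM` and the perfect matching `μ`, the women and the
men both being numbered `0, …, n - 1`. Register 0 holds `n`; row `m` of array 0 holds the
preference list of the man `m`, and cell `(m, 0)` of array 1 its length; cell `(w, 0)` of array 2
holds the partner `μ w` of the woman `w`. All else is zero. -/
def inputState (n : ℕ) (PM : Profile (Fin n) (Fin n)) (μ : Fin n ≃ Fin n) : RAMState where
  reg := fun x => if x = 0 then n else 0
  arr := fun a i j =>
    if h : i < n then
      if a = 0 then (((PM ⟨i, h⟩).toList[j]?).map Fin.val).getD 0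
      else if a = 1 ∧ j = 0 then (PM ⟨i, h⟩).toList.length
      else if a = 2 ∧ j = 0 then (μ ⟨i, h⟩).val
      else 0
    else 0

/-- The final state `s` holds the women's profile `PW`: row `w` of array 3 starts with the
preference list of the woman `w`, and cell `(w, 0)` of array 4 is its length. -/
def IsOutput {n : ℕ} (s : RAMState) (PW : Profile (Fin n) (Fin n)) : Prop :=
  ∀ w : Fin n, s.arr 4 w 0 = (PW w).toList.length ∧
    ∀ (j : ℕ) (hj : j < (PW w).toList.length), s.arr 3 w j = ((PW w).toList[j]).val

/-- Every man has a top choice, and the top choices of different men are different. -/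
def DistinctTopChoices {n : ℕ} (PM : Profile (Fin n) (Fin n)) : Prop :=
  ∃ top : Fin n → Fin n, Function.Injective top ∧ ∀ m, (PM m).toList.head? = some (top m)

open Classical in
/-- The set of all `M`-rational perfect matchings. -/
noncomputable def rationalPerfectMatchings {n : ℕ} (PM : Profile (Fin n) (Fin n)) :
    Finset (Fin n ≃ Fin n) :=
  Finset.univ.filter fun μ => IsMRational PM μ.toPEquiv

/-- The mean of `f μ` for a uniformly distributed `M`-rational perfect matching `μ`. -/
noncomputable def averageOverMatchings {n : ℕ} (PM : Profile (Fin n) (Fin n))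
    (f : (Fin n ≃ Fin n) → ℕ) : ℝ :=
  (∑ μ ∈ rationalPerfectMatchings PM, (f μ : ℝ)) / ((rationalPerfectMatchings PM).card : ℝ)

/-!
Men propose as in deferred acceptance, but the women's preferences are decided on the way: a woman
ranks the men whom she has rejected in the reverse order of the rejections, below all the others,
and her intended partner on top. Then `μ` is stable, because no woman can do better, and every
man's partner in a stable matching is at least as good as his partner in `μ`. If the process ends
with `μ`, then it also is at most as good (`ProposalState.Inv.rejected`), so `μ` is the only stable
matching (`ProposalState.Inv.forcesInconspicuously`).

Call the man `μ w` by the name `w`. The proposals held give a partial injection of the names, with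
paths and cycles. Names are collected into classes closed under this injection. In each class, a
root is kept who is either the only free woman, or has not rejected anybody, and lies on every
cycle of the class that is not a fixed point (`ProposalState.Inv.root_mem`). To preserve this, a
woman gives up the man whom she holds for another proposer only if the proposer is her intended
partner, or if he belongs to another class and her own class has no free woman; in the latter case
the two classes are merged.

First the men enter one by one, until everybody is matched. Then, as long as there is a root not
matched as intended, she blacklists the man whom she holds and all later proposers up to her
intended partner. When he arrives, the class has no free woman and its root is on no cycle, so that
all its members are matched as intended, and the class will never change again. All men whom the
root blacklisted belong to her class, and she herself names another man of the class. As the classes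
are disjoint, so are the blacklists, and their sizes plus their number add up to at most `n`.

A man proposes to each woman at most once. Relabelling a class takes linear time; it happens at most
once for every entering man, and otherwise merges two different classes. Hence the machine needs
`O(n ^ 2)` steps on every input (`exec_algorithm`), and this implies the bounds for the worst, the
best and the average case.
-/

/-! ### Positions in duplicate-free lists -/

section Lists

variable {V : Type*}

/-- A woman is not among the first `k` of a duplicate-free list if she is at position `k`. -/
theorem List.Nodup.notMem_take_of_getElem? {l : List V} (hl : l.Nodup) {k : ℕ} {w : V}
    (h : l[k]? = some w) : w ∉ l.take k := by
  intro hw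
  obtain ⟨j, hj, hjw⟩ := List.mem_take_iff_getElem.1 hw
  obtain ⟨hk, hkw⟩ := List.getElem?_eq_some_iff.1 h
  have := (hl.getElem_inj_iff (hi := by omega) (hj := hk)).1 (hjw.trans hkw.symm)
  omega

theorem PrefList.prefers_of_suffix {L : PrefList V} {a h : V} {l : List V}
    (hs : a :: l <:+ L.toList) (hL : h ∈ L.toList) (ha : h ≠ a) (hl : h ∉ l) :
    L.Prefers h a := by
  obtain ⟨t, ht⟩ := hs
  rw [PrefList.Prefers, ← ht]
  rw [← ht] at hL
  simp only [List.mem_append, List.mem_cons, ha, hl, or_false] at hL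
  have : [h].Sublist t := by simpa using hL
  exact this.append (l₂ := t) (r₁ := [a]) (by simp)

/-- The woman at position `k` is preferred to every woman on the list who is not among the first
`k + 1`. -/
theorem PrefList.prefers_of_notMem_take {L : PrefList V} {k : ℕ} {w v : V}
    (hk : L.toList[k]? = some w) (hv : v ∈ L.toList) (hvk : v ∉ L.toList.take k) (hvw : v ≠ w) :
    L.Prefers w v := by
  obtain ⟨hk', rfl⟩ := List.getElem?_eq_some_iff.1 hk
  have h0 : L.toList.drop k = L.toList[k] :: L.toList.drop (k + 1) := List.drop_eq_getElem_cons hk'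
  rw [← List.take_append_drop k L.toList, List.mem_append, h0, List.mem_cons] at hv
  have hv' : v ∈ L.toList.drop (k + 1) := by tauto
  have : [L.toList[k], v].Sublist (L.toList.drop k) := by
    rw [h0]
    exact List.Sublist.cons_cons _ (by simpa using hv')
  exact this.trans (List.drop_sublist _ _)

end Lists

/-! ### Deferred acceptance with rejections decided on the way -/

/-- A state of the proposal process. Men and women are both named by elements of `V`, the man `i`
being the partner intended for the woman `i`. -/
structure ProposalState (V : Type*) where
  /-- the man whose proposal a woman currently holds -/
  hold : V → Option V
  /-- the root of the class of a woman; the man `i` belongs to the class of the woman `i` -/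
  lab : V → V
  /-- the position, in the list of a man, of the woman whom he addresses -/
  ptr : V → ℕ
  /-- the men whom a woman has rejected without blacklisting them, latest first -/
  log : V → List V
  /-- the men whom a woman has blacklisted -/
  bl : V → Finset V

namespace ProposalState

variable {V : Type*}

/-- Nobody has proposed yet, and every class is a singleton. -/
def init : ProposalState V := ⟨fun _ => none, id, fun _ => 0, fun _ => [], fun _ => ∅⟩

/-- No woman holds a proposal of the man `i`. -/
def Free (σ : ProposalState V) (i : V) : Prop := ∀ w, σ.hold w ≠ some i

/-- The women's profile `PW` is a possible continuation of the decisions taken so far: the men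
logged by `w` end her list in the order of `σ.log w`, those she has blacklisted are not on it, and
once she has logged somebody she blacklists nobody else. -/
def Compatible (σ : ProposalState V) (PW : Profile V V) : Prop :=
  ∀ w, σ.log w <:+ (PW w).toList ∧ (∀ i ∈ σ.bl w, i ∉ (PW w).toList) ∧
    (σ.log w ≠ [] → ∀ i, i ∈ (PW w).toList ∨ i ∈ σ.bl w)

/-- The invariant of the proposal process. A class is a set of women, together with the men of the
same names; it is closed under `σ.hold`, and no woman of the class other than its root is free. -/
structure Inv (P : Profile V V) (σ : ProposalState V) : Prop where
  inj : ∀ w w' i, σ.hold w = some i → σ.hold w' = some i → w = w'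
  lab_hold : ∀ w i, σ.hold w = some i → σ.lab i = σ.lab w
  lab_idem : ∀ w, σ.lab (σ.lab w) = σ.lab w
  /-- Every cycle of `σ.hold`, other than a fixed point, passes through the root of its class. -/
  root_mem : ∀ r (X : Finset V), X.Nonempty →
    (∀ x ∈ X, σ.lab x = r ∧ ∃ y ∈ X, y ≠ x ∧ σ.hold x = some y) → r ∈ X
  free_root : ∀ w, σ.hold w = none → σ.lab w = w
  /-- A root not matched as intended has not rejected anybody. -/
  log_root : ∀ w, σ.lab w = w → σ.hold w ≠ some w → σ.log w = []
  log_nodup : ∀ w, (σ.log w).Nodup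
  log_bl : ∀ w i, i ∈ σ.log w → i ∉ σ.bl w
  /-- A man has proposed in vain to those women who precede the one whom he addresses. -/
  mem_take : ∀ w i, w ∈ (P i).toList.take (σ.ptr i) ↔ i ∈ σ.log w ∨ i ∈ σ.bl w
  next : ∀ w i, σ.hold w = some i → (P i).toList[σ.ptr i]? = some w
  self_log : ∀ w, w ∉ σ.log w
  self_bl : ∀ w, w ∉ σ.bl w
  /-- Blacklists are disjoint, because only a root has a nonempty one, and within her own class. -/
  bl_root : ∀ w i, i ∈ σ.bl w → σ.lab w = w ∧ σ.lab i = w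
  /-- A woman with a nonempty blacklist waits for her intended partner, or holds him. -/
  bl_hold : ∀ w i, i ∈ σ.bl w → σ.hold w = none ∨ σ.hold w = some w
  /-- Rejections are final: no stable matching contains a rejected pair. -/
  rejected : ∀ PW, σ.Compatible PW → ∀ ν : Matching V V, IsStable PW P ν →
    ∀ w i, i ∈ σ.log w ∨ i ∈ σ.bl w → ν w ≠ some i

theorem inv_init (P : Profile V V) : Inv P init where
  inj := by simp [init]
  lab_hold := by simp [init]
  lab_idem := by simp [init]
  root_mem := by
    rintro r X ⟨x, hx⟩ h
    obtain ⟨-, y, -, -, h⟩ := h x hx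
    simp [init] at h
  free_root := by simp [init]
  log_root := by simp [init]
  log_nodup := by simp [init]
  log_bl := by simp [init]
  mem_take := by simp [init]
  next := by simp [init]
  self_log := by simp [init]
  self_bl := by simp [init]
  bl_root := by simp [init]
  bl_hold := by simp [init]
  rejected := by simp [init]

namespace Inv

variable {P : Profile V V} {σ : ProposalState V}

theorem notMem_of_next (h : Inv P σ) {w i : V} (hi : (P i).toList[σ.ptr i]? = some w) :
    i ∉ σ.log w ∧ i ∉ σ.bl w := by
  have := mt (h.mem_take w i).2 ((P i).nodup.notMem_take_of_getElem? hi)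
  tauto

theorem exists_next (h : Inv P σ) (hP : ∀ i, i ∈ (P i).toList) (i : V) :
    ∃ w, (P i).toList[σ.ptr i]? = some w := by
  by_contra! hc
  have hlen : (P i).toList.length ≤ σ.ptr i := by
    by_contra hlt
    push Not at hlt
    exact hc _ (List.getElem?_eq_getElem hlt)
  have := (h.mem_take i i).1 (by rw [List.take_of_length_le hlen]; exact hP i)
  exact this.elim (h.self_log i) (h.self_bl i)

theorem ptr_lt (h : Inv P σ) (hP : ∀ i, i ∈ (P i).toList) (i : V) :
    σ.ptr i < (P i).toList.length := by
  obtain ⟨w, hw⟩ := h.exists_next hP i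
  exact (List.getElem?_eq_some_iff.1 hw).1

variable [Fintype V] [DecidableEq V]

/-- In a class, the number of free men is the number of free women, and only the root may be a free
woman. -/
theorem hold_lab_of_free (h : Inv P σ) {i : V} (hi : σ.Free i) : σ.hold (σ.lab i) = none := by
  by_contra hne
  have hsome : ∀ x, σ.lab x = σ.lab i → ∃ y, σ.hold x = some y := by
    intro x hx
    rw [← Option.ne_none_iff_exists']
    intro hx0
    rw [← hx, h.free_root x hx0] at hne
    exact hne hx0
  have hsurj : Set.SurjOn (fun x => (σ.hold x).getD x)
      ((Finset.univ.filter fun x => σ.lab x = σ.lab i : Finset V) : Set V)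
      ((Finset.univ.filter fun x => σ.lab x = σ.lab i : Finset V) : Set V) := by
    refine Finset.surjOn_of_injOn_of_card_le _ ?_ ?_ le_rfl
    · intro x hx
      simp only [Finset.coe_filter, Finset.mem_univ, true_and, Set.mem_ofPred_eq] at hx ⊢
      obtain ⟨y, hy⟩ := hsome x hx
      simpa [hy] using (h.lab_hold x y hy).trans hx
    · intro x hx x' hx' he
      simp only [Finset.coe_filter, Finset.mem_univ, true_and, Set.mem_ofPred_eq] at hx hx'
      obtain ⟨y, hy⟩ := hsome x hx
      obtain ⟨y', hy'⟩ := hsome x' hx'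
      simp only [hy, hy', Option.getD_some] at he
      exact h.inj x x' y hy (he ▸ hy')
  obtain ⟨x, hx, hxi⟩ := hsurj (a := i) (by simp)
  simp only [Finset.coe_filter, Finset.mem_univ, true_and, Set.mem_ofPred_eq] at hx
  obtain ⟨y, hy⟩ := hsome x hx
  simp only [hy, Option.getD_some] at hxi
  exact hi x (hxi ▸ hy)

/-- A class whose root is matched as intended is matched as intended. -/
theorem hold_self_of_root (h : Inv P σ) {r w : V} (hr : σ.hold r = some r) (hw : σ.lab w = r) :
    σ.hold w = some w := by
  by_contra hne
  have := h.root_mem r (Finset.univ.filter fun x => σ.lab x = r ∧ σ.hold x ≠ some x)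
    ⟨w, by simp [hw, hne]⟩ (by
      intro x hx
      simp only [Finset.mem_filter, Finset.mem_univ, true_and] at hx ⊢
      refine ⟨hx.1, ?_⟩
      rcases hy : σ.hold x with _ | y
      · have := (h.free_root x hy).symm.trans hx.1
        subst this
        simp [hr] at hy
      · have hyx : y ≠ x := by rintro rfl; exact hx.2 hy
        exact ⟨y, ⟨(h.lab_hold x y hy).trans hx.1, fun hyy => hyx (h.inj y x y hyy hy)⟩, hyx,
          rfl⟩)
  simp [hr] at this

/-- Let `X` be a union of cycles of `σ.hold` in a class without a free woman. If the class contains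
another woman not matched as intended, then `X` does not contain the root, because the cycle of that
woman does. -/
theorem root_notMem (h : Inv P σ) {r w : V} (hr : σ.hold r ≠ none) (hw : σ.lab w = r)
    (hww : σ.hold w ≠ some w) {X : Finset V}
    (hX : ∀ x ∈ X, σ.lab x = r ∧ ∃ y ∈ X, y ≠ x ∧ σ.hold x = some y) (hwX : w ∉ X) :
    r ∉ X := by
  have hsurj : Set.SurjOn (fun x => (σ.hold x).getD x) (X : Set V) (X : Set V) := by
    refine Finset.surjOn_of_injOn_of_card_le _ ?_ ?_ le_rfl
    · intro x hx
      obtain ⟨-, y, hy, -, hxy⟩ := hX x hx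
      simpa [hxy] using hy
    · intro x hx x' hx' he
      obtain ⟨-, y, hy, -, hxy⟩ := hX x hx
      obtain ⟨-, y', hy', -, hxy'⟩ := hX x' hx'
      simp only [hxy, hxy', Option.getD_some] at he
      exact h.inj x x' y hxy (he ▸ hxy')
  have := h.root_mem r
    (Finset.univ.filter fun x => σ.lab x = r ∧ σ.hold x ≠ some x ∧ x ∉ X)
    ⟨w, by simp [hw, hww, hwX]⟩ (by
      intro x hx
      simp only [Finset.mem_filter, Finset.mem_univ, true_and] at hx ⊢
      refine ⟨hx.1, ?_⟩
      rcases hy : σ.hold x with _ | y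
      · have := (h.free_root x hy).symm.trans hx.1
        subst this
        exact absurd hy hr
      · have hyx : y ≠ x := by rintro rfl; exact hx.2.1 hy
        refine ⟨y, ⟨(h.lab_hold x y hy).trans hx.1, fun hyy => hyx (h.inj y x y hyy hy), ?_⟩, hyx,
          rfl⟩
        intro hyX
        obtain ⟨x', hx', hxy⟩ := hsurj hyX
        obtain ⟨-, y', -, -, hxy'⟩ := hX x' hx'
        simp only [hxy', Option.getD_some] at hxy
        exact hx.2.2 (h.inj x x' y hy (hxy ▸ hxy') ▸ hx'))
  simp only [Finset.mem_filter, Finset.mem_univ, true_and] at this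
  exact this.2.2

end Inv

variable [DecidableEq V]

/-- The woman `w` holds the man `a`, and her class is merged into his. -/
def assign (σ : ProposalState V) (w a : V) : ProposalState V :=
  { σ with
    hold := Function.update σ.hold w (some a)
    lab := fun v => if σ.lab v = σ.lab w then σ.lab a else σ.lab v }

/-- The woman `w` rejects the man `x`. -/
def drop (σ : ProposalState V) (w x : V) : ProposalState V :=
  { σ with
    log := Function.update σ.log w (x :: σ.log w)
    ptr := Function.update σ.ptr x (σ.ptr x + 1) }

/-- The woman `w` blacklists the man `x`. -/
def ban (σ : ProposalState V) (w x : V) : ProposalState V :=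
  { σ with
    bl := Function.update σ.bl w (insert x (σ.bl w))
    ptr := Function.update σ.ptr x (σ.ptr x + 1) }

/-- The woman `r` gives up the proposal that she holds. -/
def dismiss (σ : ProposalState V) (r : V) : ProposalState V :=
  { σ with hold := Function.update σ.hold r none }

namespace Inv

variable {P : Profile V V} {σ : ProposalState V}

theorem lab_root_of_assign (h : Inv P σ) {w a v : V} (hv : (σ.assign w a).lab v = v) :
    σ.lab v = v := by
  simp only [assign] at hv
  split_ifs at hv with h1
  · rw [← hv]; exact h.lab_idem a
  · exact hv

theorem assign_lab_eq {w a : V} (hl : σ.lab w = σ.lab a) :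
    (σ.assign w a).lab = σ.lab := by
  funext v
  simp only [assign]
  split_ifs with h1
  · rw [h1, hl]
  · rfl

/-- The woman `w` may hold the man `a` if he is her intended partner, if she is free and has
blacklisted nobody, or if her class is another one without a free woman and she is not matched as
intended. -/
theorem assign [Fintype V] (h : Inv P σ) {w a : V} (ha : σ.Free a)
    (hn : (P a).toList[σ.ptr a]? = some w)
    (hc : w = a ∨ (σ.hold w = none ∧ σ.bl w = ∅) ∨
      (σ.hold (σ.lab w) ≠ none ∧ σ.lab w ≠ σ.lab a ∧ σ.hold w ≠ some w)) :
    Inv P (σ.assign w a) := by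
  have hK : ∀ r i, i ∈ σ.bl r → σ.lab w = r → σ.lab w = σ.lab a := by
    rintro r i hi rfl
    rcases hc with rfl | ⟨h1, h2⟩ | ⟨h1, h2, h3⟩
    · rfl
    · rw [h.free_root w h1, h2] at hi
      simp at hi
    · rcases h.bl_hold _ _ hi with h4 | h4
      · exact absurd h4 h1
      · exact absurd (h.hold_self_of_root h4 rfl) h3
  constructor
  case inj =>
    intro u u' i hu hu'
    simp only [ProposalState.assign, Function.update_apply] at hu hu'
    split_ifs at hu hu' with h1 h2 h2
    · exact h1.trans h2.symm
    · cases hu; exact absurd hu' (ha u')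
    · cases hu'; exact absurd hu (ha u)
    · exact h.inj u u' i hu hu'
  case lab_hold =>
    intro u i hu
    simp only [ProposalState.assign, Function.update_apply] at hu ⊢
    split_ifs at hu with h1
    · cases hu
      subst h1
      simp
    · rw [h.lab_hold u i hu]
  case lab_idem =>
    intro u
    simp only [ProposalState.assign]
    split_ifs with h1 h2 h2 <;> simp_all [h.lab_idem]
  case root_mem =>
    intro r X hX hXc
    have hold_ne : ∀ x, x ≠ w → (σ.assign w a).hold x = σ.hold x := fun x hx => by
      simp [ProposalState.assign, hx]
    have hold_w : (σ.assign w a).hold w = some a := by simp [ProposalState.assign]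
    by_cases hl : σ.lab w = σ.lab a
    · rw [assign_lab_eq hl] at hXc
      by_cases hwX : w ∈ X
      · obtain ⟨h1, y, hy, hyw, hyh⟩ := hXc w hwX
        rw [hold_w] at hyh
        cases hyh
        rcases hc with rfl | ⟨h2, -⟩ | ⟨-, h2, -⟩
        · exact absurd rfl hyw
        · rwa [← h1, h.free_root w h2]
        · exact absurd hl h2
      · refine h.root_mem r X hX fun x hx => ?_
        obtain ⟨h1, y, hy, hyx, hyh⟩ := hXc x hx
        rw [hold_ne x (by rintro rfl; exact hwX hx)] at hyh
        exact ⟨h1, y, hy, hyx, hyh⟩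
    · have lab' : ∀ x, (σ.assign w a).lab x = if σ.lab x = σ.lab w then σ.lab a else σ.lab x :=
        fun x => rfl
      by_cases hr : r = σ.lab a
      · subst hr
        by_cases hne : (X.filter fun x => σ.lab x = σ.lab a).Nonempty
        · refine (Finset.mem_filter.1 (h.root_mem (σ.lab a) _ hne fun x hx => ?_)).1
          rw [Finset.mem_filter] at hx
          obtain ⟨h1, y, hy, hyx, hyh⟩ := hXc x hx.1
          rw [hold_ne x (by rintro rfl; exact hl hx.2)] at hyh
          exact ⟨hx.2, y, Finset.mem_filter.2 ⟨hy, (h.lab_hold x y hyh).trans hx.2⟩, hyx, hyh⟩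
        -- otherwise `X` lies in the old class of `w` and avoids `w`, whose cycle has been cut
        · exfalso
          have hno : ∀ x ∈ X, σ.lab x ≠ σ.lab a := fun x hx hxa =>
            hne ⟨x, Finset.mem_filter.2 ⟨hx, hxa⟩⟩
          have hwX : w ∉ X := by
            intro hwX
            obtain ⟨-, y, hy, -, hyh⟩ := hXc w hwX
            rw [hold_w] at hyh
            cases hyh
            exact hno _ hy rfl
          have hold : ∀ x ∈ X, σ.lab x = σ.lab w ∧ ∃ y ∈ X, y ≠ x ∧ σ.hold x = some y := by
            intro x hx
            obtain ⟨h1, y, hy, hyx, hyh⟩ := hXc x hx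
            rw [hold_ne x (by rintro rfl; exact hwX hx)] at hyh
            refine ⟨?_, y, hy, hyx, hyh⟩
            by_contra h2
            rw [lab', if_neg h2] at h1
            exact hno x hx h1
          have hmem := h.root_mem _ X hX hold
          rcases hc with rfl | ⟨h2, -⟩ | ⟨h2, -, h3⟩
          · exact hl rfl
          · rw [h.free_root w h2] at hmem
            exact hwX hmem
          · exact h.root_notMem h2 rfl h3 hold hwX hmem
      · refine h.root_mem r X hX fun x hx => ?_
        obtain ⟨h1, y, hy, hyx, hyh⟩ := hXc x hx
        rw [lab'] at h1
        split_ifs at h1 with h2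
        · exact absurd h1.symm hr
        · rw [hold_ne x (by rintro rfl; exact h2 rfl)] at hyh
          exact ⟨h1, y, hy, hyx, hyh⟩
  case free_root =>
    intro u hu
    simp only [ProposalState.assign, Function.update_apply] at hu ⊢
    split_ifs at hu with h1
    have h2 := h.free_root u hu
    split_ifs with h3
    · rcases hc with rfl | ⟨h4, -⟩ | ⟨h4, -, -⟩
      · exact h3 ▸ h2
      · exact absurd (h2.symm.trans (h3.trans (h.free_root w h4))) h1
      · rw [← h3, h2] at h4
        exact absurd hu h4
    · exact h2
  case log_root =>
    intro u hu hu'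
    have h1 := h.lab_root_of_assign hu
    by_cases huw : u = w
    · subst huw
      refine h.log_root u h1 ?_
      rcases hc with rfl | ⟨h4, -⟩ | ⟨-, h4, -⟩
      · simp [ProposalState.assign] at hu'
      · simp [h4]
      · simp only [ProposalState.assign, if_true] at hu
        rw [h1, hu] at h4
        exact absurd rfl h4
    · exact h.log_root u h1 (by simpa [ProposalState.assign, huw] using hu')
  case log_nodup => exact h.log_nodup
  case log_bl => exact h.log_bl
  case mem_take => exact h.mem_take
  case next =>
    intro u i hu
    simp only [ProposalState.assign, Function.update_apply] at hu ⊢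
    split_ifs at hu with h1
    · cases hu
      rw [h1]
      exact hn
    · exact h.next u i hu
  case self_log => exact h.self_log
  case self_bl => exact h.self_bl
  case bl_root =>
    intro r i hi
    obtain ⟨h1, h2⟩ := h.bl_root r i hi
    by_cases hrw : σ.lab w = r
    · rw [assign_lab_eq (hK r i hi hrw)]
      exact ⟨h1, h2⟩
    · simp only [ProposalState.assign, h1, h2, if_neg (Ne.symm hrw), and_self]
  case bl_hold =>
    intro r i hi
    have h1 := h.bl_hold r i hi
    by_cases hrw : r = w
    · subst hrw
      rcases hc with rfl | ⟨-, h4⟩ | ⟨h4, h5, h6⟩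
      · simp [ProposalState.assign]
      · have hi' : i ∈ σ.bl r := hi
        simp [h4] at hi'
      · rw [(h.bl_root r i hi).1] at h4
        tauto
    · simpa [ProposalState.assign, hrw] using h1
  case rejected => exact h.rejected

theorem compatible_of_drop {w x : V} {PW : Profile V V}
    (hPW : (σ.drop w x).Compatible PW) : σ.Compatible PW := by
  intro u
  obtain ⟨h1, h2, h3⟩ := hPW u
  by_cases hu : u = w
  · subst hu
    simp only [drop, Function.update_self] at h1 h3
    exact ⟨(List.suffix_cons _ _).trans h1, h2, fun _ => h3 (by simp)⟩
  · simp only [drop, Function.update_of_ne hu] at h1 h3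
    exact ⟨h1, h2, h3⟩

/-- A man who addresses `w` prefers her to any other partner in a stable matching, since that
partner cannot be one of the women who rejected him, who are all those whom he prefers to `w`. -/
theorem man_blocks (h : Inv P σ) {PW : Profile V V} (hPW : σ.Compatible PW) {ν : Matching V V}
    (hν : IsStable PW P ν) {w i : V} (hn : (P i).toList[σ.ptr i]? = some w) (hw : ν w ≠ some i) :
    ν.symm i = none ∨ ∃ w', ν.symm i = some w' ∧ (P i).Prefers w w' := by
  rcases hi : ν.symm i with _ | w'
  · exact Or.inl rfl
  · right
    have hw' : ν w' = some i := (PEquiv.eq_some_iff ν).1 hi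
    refine ⟨w', rfl, PrefList.prefers_of_notMem_take hn ?_ ?_ ?_⟩
    · by_contra hc
      exact hν.2.1 i w' hi hc
    · intro hc
      exact h.rejected PW hPW ν hν w' i ((h.mem_take w' i).1 hc) hw'
    · rintro rfl
      exact hw hw'

/-- A woman may reject a man who proposes to her if she holds another man, unless she is a root not
matched as intended: such a root may have to blacklist the man she holds, and must not have rejected
anybody in his favour. -/
theorem drop (h : Inv P σ) {w x : V} (hx : σ.Free x) (hn : (P x).toList[σ.ptr x]? = some w)
    (hxw : x ≠ w) (hh : σ.hold w ≠ none) (hr : σ.hold w = some w ∨ σ.lab w ≠ w) :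
    Inv P (σ.drop w x) := by
  obtain ⟨hxl, hxb⟩ := h.notMem_of_next hn
  have ptr_ne : ∀ i, i ≠ x → (σ.drop w x).ptr i = σ.ptr i := fun i hi => by
    simp [ProposalState.drop, hi]
  have mem_log : ∀ u i, i ∈ (σ.drop w x).log u ↔ i ∈ σ.log u ∨ (u = w ∧ i = x) := by
    intro u i
    by_cases hu : u = w
    · subst hu
      simp [ProposalState.drop, or_comm]
    · simp [ProposalState.drop, hu]
  constructor
  case inj => exact h.inj
  case lab_hold => exact h.lab_hold
  case lab_idem => exact h.lab_idem
  case root_mem => exact h.root_mem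
  case free_root => exact h.free_root
  case log_root =>
    intro u hu hu'
    have huw : u ≠ w := by
      rintro rfl
      exact hr.elim hu' (fun h' => h' hu)
    simpa [ProposalState.drop, huw] using h.log_root u hu hu'
  case log_nodup =>
    intro u
    by_cases hu : u = w
    · subst hu
      simpa [ProposalState.drop, hxl] using h.log_nodup u
    · simpa [ProposalState.drop, hu] using h.log_nodup u
  case log_bl =>
    intro u i hi
    rw [mem_log] at hi
    rcases hi with hi | ⟨rfl, rfl⟩
    · exact h.log_bl u i hi
    · exact hxb
  case mem_take =>
    intro u i
    rw [mem_log]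
    by_cases hi : i = x
    · subst hi
      simp only [ProposalState.drop, Function.update_self, List.take_add_one, hn,
        List.mem_append, h.mem_take u i]
      simp only [Option.toList_some, List.mem_singleton, and_true]
      tauto
    · rw [ptr_ne i hi, h.mem_take]
      simp [hi, ProposalState.drop]
  case next =>
    intro u i hu
    have hi : i ≠ x := by rintro rfl; exact hx u hu
    rw [ptr_ne i hi]
    exact h.next u i hu
  case self_log =>
    intro u hu
    rw [mem_log] at hu
    rcases hu with hu | ⟨rfl, rfl⟩
    · exact h.self_log u hu
    · exact hxw rfl
  case self_bl => exact h.self_bl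
  case bl_root => exact h.bl_root
  case bl_hold => exact h.bl_hold
  case rejected =>
    intro PW hPW ν hν u i hi
    have hPW' := compatible_of_drop hPW
    rw [mem_log, or_right_comm] at hi
    rcases hi with hi | ⟨rfl, rfl⟩
    · exact h.rejected PW hPW' ν hν u i hi
    · intro hc
      obtain ⟨m, hm⟩ := Option.ne_none_iff_exists'.1 hh
      have hmi : m ≠ i := by rintro rfl; exact hx _ hm
      have hmn := h.next u m hm
      obtain ⟨hml, hmb⟩ := h.notMem_of_next hmn
      obtain ⟨h1, h2, h3⟩ := hPW u
      simp only [ProposalState.drop, Function.update_self] at h1 h3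
      have hmP : m ∈ (PW u).toList := (h3 (by simp) m).resolve_right hmb
      refine hν.2.2 u m ⟨by simpa [PrefList.blacklist] using hmP, ?_, Or.inr ⟨i, hc, ?_⟩,
        h.man_blocks hPW' hν hmn (by rw [hc]; simpa using hmi.symm)⟩
      · simpa [PrefList.blacklist] using List.mem_of_getElem? hmn
      · exact PrefList.prefers_of_suffix h1 hmP hmi hml

/-- The free root of a class may blacklist the men of the class who propose to her, except the
intended one. -/
theorem ban (h : Inv P σ) {w x : V} (hx : σ.Free x) (hn : (P x).toList[σ.ptr x]? = some w)
    (hxw : x ≠ w) (hh : σ.hold w = none) (hl : σ.lab x = w) : Inv P (σ.ban w x) := by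
  obtain ⟨hxl, hxb⟩ := h.notMem_of_next hn
  have hlog : σ.log w = [] := h.log_root w (h.free_root w hh) (by simp [hh])
  have ptr_ne : ∀ i, i ≠ x → (σ.ban w x).ptr i = σ.ptr i := fun i hi => by
    simp [ProposalState.ban, hi]
  have mem_bl : ∀ u i, i ∈ (σ.ban w x).bl u ↔ i ∈ σ.bl u ∨ (u = w ∧ i = x) := by
    intro u i
    by_cases hu : u = w
    · subst hu
      simp [ProposalState.ban, or_comm]
    · simp [ProposalState.ban, hu]
  constructor
  case inj => exact h.inj
  case lab_hold => exact h.lab_hold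
  case lab_idem => exact h.lab_idem
  case root_mem => exact h.root_mem
  case free_root => exact h.free_root
  case log_root => exact h.log_root
  case log_nodup => exact h.log_nodup
  case log_bl =>
    intro u i hi
    rw [mem_bl]
    rintro (hi' | ⟨rfl, rfl⟩)
    · exact h.log_bl u i hi hi'
    · exact hxl hi
  case mem_take =>
    intro u i
    rw [mem_bl]
    by_cases hi : i = x
    · subst hi
      simp only [ProposalState.ban, Function.update_self, List.take_add_one, hn,
        List.mem_append, h.mem_take u i]
      simp only [Option.toList_some, List.mem_singleton, and_true]
      tauto
    · rw [ptr_ne i hi, h.mem_take]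
      simp [hi, ProposalState.ban]
  case next =>
    intro u i hu
    have hi : i ≠ x := by rintro rfl; exact hx u hu
    rw [ptr_ne i hi]
    exact h.next u i hu
  case self_log => exact h.self_log
  case self_bl =>
    intro u hu
    rw [mem_bl] at hu
    rcases hu with hu | ⟨rfl, rfl⟩
    · exact h.self_bl u hu
    · exact hxw rfl
  case bl_root =>
    intro u i hi
    rw [mem_bl] at hi
    rcases hi with hi | ⟨rfl, rfl⟩
    · exact h.bl_root u i hi
    · exact ⟨h.free_root u hh, hl⟩
  case bl_hold =>
    intro u i hi
    rw [mem_bl] at hi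
    rcases hi with hi | ⟨rfl, rfl⟩
    · exact h.bl_hold u i hi
    · exact Or.inl hh
  case rejected =>
    intro PW hPW ν hν u i hi
    have hPW' : σ.Compatible PW := by
      intro v
      obtain ⟨h1, h2, h3⟩ := hPW v
      refine ⟨h1, fun i hi => h2 i ((mem_bl v i).2 (Or.inl hi)), fun hv => ?_⟩
      have hvw : v ≠ w := by rintro rfl; exact hv hlog
      simpa [ProposalState.ban, hvw] using h3 hv
    rw [mem_bl, ← or_assoc] at hi
    rcases hi with hi | ⟨rfl, rfl⟩
    · exact h.rejected PW hPW' ν hν u i hi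
    · intro hc
      exact hν.1 u i hc ((hPW u).2.1 i ((mem_bl u i).2 (Or.inr ⟨rfl, rfl⟩)))

theorem dismiss (h : Inv P σ) {r b : V} (hr : σ.lab r = r) (hb : σ.hold r = some b) (hbr : b ≠ r) :
    Inv P (σ.dismiss r) := by
  have hold : ∀ u i, (σ.dismiss r).hold u = some i → u ≠ r ∧ σ.hold u = some i := by
    intro u i hu
    by_cases hur : u = r
    · subst hur
      simp [ProposalState.dismiss] at hu
    · exact ⟨hur, by simpa [ProposalState.dismiss, hur] using hu⟩
  constructor
  case inj => exact fun u u' i hu hu' => h.inj u u' i (hold u i hu).2 (hold u' i hu').2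
  case lab_hold => exact fun u i hu => h.lab_hold u i (hold u i hu).2
  case lab_idem => exact h.lab_idem
  case root_mem =>
    intro q X hX hXc
    refine h.root_mem q X hX fun x hx => ?_
    obtain ⟨h1, y, hy, hyx, hyh⟩ := hXc x hx
    exact ⟨h1, y, hy, hyx, (hold x y hyh).2⟩
  case free_root =>
    intro u hu
    by_cases hur : u = r
    · exact hur ▸ hr
    · exact h.free_root u (by simpa [ProposalState.dismiss, hur] using hu)
  case log_root =>
    intro u hu hu'
    by_cases hur : u = r
    · subst hur
      exact h.log_root u hu (by simp [hb, hbr])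
    · exact h.log_root u hu (by simpa [ProposalState.dismiss, hur] using hu')
  case log_nodup => exact h.log_nodup
  case log_bl => exact h.log_bl
  case mem_take => exact h.mem_take
  case next => exact fun u i hu => h.next u i (hold u i hu).2
  case self_log => exact h.self_log
  case self_bl => exact h.self_bl
  case bl_root => exact h.bl_root
  case bl_hold =>
    intro u i hi
    by_cases hur : u = r
    · exact Or.inl (by simp [ProposalState.dismiss, hur])
    · simpa [ProposalState.dismiss, hur] using h.bl_hold u i hi
  case rejected => exact h.rejected

/-- When every woman holds the intended man, the women's lists that put him first and the logged
men last do what they should. -/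
theorem forcesInconspicuously [Fintype V] (h : Inv P σ) (hP : ∀ i, i ∈ (P i).toList)
    (hold : ∀ w, σ.hold w = some w) {PW : Profile V V}
    (hPW : ∀ w, ∃ l, (PW w).toList = w :: (l ++ σ.log w))
    (hbl : ∀ w i, i ∈ (PW w).toList ↔ i ∉ σ.bl w) :
    ForcesInconspicuously P (Equiv.refl V) PW := by
  have hcomp : σ.Compatible PW := by
    intro w
    obtain ⟨l, hl⟩ := hPW w
    refine ⟨⟨w :: l, by simp [hl]⟩, fun i hi => by simpa [hbl] using hi, fun _ i => ?_⟩
    rw [hbl]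
    tauto
  have hB : ∀ w, (PW w).blacklist = (σ.bl w : Set V) := by
    intro w
    ext i
    simp [PrefList.blacklist, hbl]
  have hcard : combinedBlacklistSize PW + numNonemptyBlacklists PW ≤ Fintype.card V := by
    have h1 : numNonemptyBlacklists PW = ∑ w, if (σ.bl w).Nonempty then 1 else 0 := by
      rw [numNonemptyBlacklists, Finset.sum_boole, ← Set.ncard_coe_finset]
      simp [hB]
    rw [h1, combinedBlacklistSize, ← Finset.sum_add_distrib]
    -- a nonempty blacklist, together with the intended partner of its owner, fits into her class
    calc ∑ w, ((PW w).blacklist.ncard + if (σ.bl w).Nonempty then 1 else 0)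
        ≤ ∑ w, (Finset.univ.filter fun i => σ.lab i = w).card := by
          refine Finset.sum_le_sum fun w _ => ?_
          rw [hB, Set.ncard_coe_finset]
          split_ifs with hw
          · rw [← Finset.card_insert_of_notMem (h.self_bl w)]
            refine Finset.card_le_card fun i hi => ?_
            obtain ⟨j, hj⟩ := hw
            rcases Finset.mem_insert.1 hi with rfl | hi
            · simpa using (h.bl_root _ j hj).1
            · simpa using (h.bl_root w i hi).2
          · rw [Finset.not_nonempty_iff_eq_empty.1 hw]
            simp
      _ = Fintype.card V := by
          rw [← Finset.card_univ]
          exact (Finset.card_eq_sum_card_fiberwise fun _ _ =>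
            Finset.mem_coe.2 (Finset.mem_univ _)).symm
  refine ⟨fun ν => ⟨fun hν => ?_, ?_⟩, ?_, ?_, hcard⟩
  · refine PEquiv.ext fun w => ?_
    by_contra hne
    have hw : ν w ≠ some w := by simpa using hne
    obtain ⟨l, hl⟩ := hPW w
    refine hν.2.2 w w ⟨by simp [PrefList.blacklist, hl], by simpa [PrefList.blacklist] using hP w,
      ?_, h.man_blocks hcomp hν (h.next w w (hold w)) hw⟩
    rcases hm : ν w with _ | m
    · exact Or.inl rfl
    · refine Or.inr ⟨m, rfl, ?_⟩
      have hmw : m ≠ w := by rintro rfl; exact hw hm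
      have hmP : m ∈ (PW w).toList := by
        by_contra hc
        exact hν.1 w m hm hc
      exact PrefList.prefers_of_notMem_take (k := 0) (by simp [hl]) hmP (by simp) hmw
  · rintro rfl
    refine ⟨fun w m hm => ?_, fun m w hm => ?_, ?_⟩
    · obtain rfl : w = m := by simpa using hm
      obtain ⟨l, hl⟩ := hPW w
      simp [PrefList.blacklist, hl]
    · obtain rfl : m = w := by simpa using hm
      simpa [PrefList.blacklist] using hP m
    · rintro w m ⟨-, -, h1 | ⟨m', h1, h2⟩, -⟩
      · simp at h1
      · obtain rfl : w = m' := by simpa using h1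
        obtain ⟨l, hl⟩ := hPW w
        have hnd := (PW w).nodup
        rw [PrefList.Prefers, hl] at h2
        rw [hl, List.nodup_cons] at hnd
        cases h2 with
        | cons _ h3 => exact hnd.1 (h3.subset (by simp))
        | cons_cons _ h3 => exact hnd.1 (h3.subset (by simp))
  · intro w w' hne
    rw [hB, hB, Finset.disjoint_coe, Finset.disjoint_left]
    intro i hi hi'
    exact hne ((h.bl_root w i hi).2.symm.trans (h.bl_root w' i hi').2)
  -- nonempty blacklists have at least one member, so the bound follows from that on the total size
  · have h2 : numNonemptyBlacklists PW ≤ combinedBlacklistSize PW := by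
      have h1 : numNonemptyBlacklists PW = ∑ w, if (σ.bl w).Nonempty then 1 else 0 := by
        rw [numNonemptyBlacklists, Finset.sum_boole, ← Set.ncard_coe_finset]
        simp [hB]
      rw [h1, combinedBlacklistSize]
      refine Finset.sum_le_sum fun w _ => ?_
      rw [hB, Set.ncard_coe_finset]
      split_ifs with hw
      · exact Finset.card_pos.2 hw
      · simp
    omega

end Inv

end ProposalState

/-! ### Reasoning about programs -/

namespace RAMState

@[simp] theorem setReg_reg (s : RAMState) (x v y : ℕ) :
    (s.setReg x v).reg y = if y = x then v else s.reg y := by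
  simp [setReg, Function.update_apply]

@[simp] theorem setReg_arr (s : RAMState) (x v : ℕ) : (s.setReg x v).arr = s.arr := rfl

@[simp] theorem setArr_reg (s : RAMState) (a i j v : ℕ) : (s.setArr a i j v).reg = s.reg := rfl

theorem setArr_arr (s : RAMState) (a i j v a' i' j' : ℕ) :
    (s.setArr a i j v).arr a' i' j' =
      if a' = a ∧ i' = i ∧ j' = j then v else s.arr a' i' j' := rfl

theorem setReg_setArr (s : RAMState) (x u a i j v : ℕ) :
    (s.setReg x u).setArr a i j v = (s.setArr a i j v).setReg x u := rfl

end RAMState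

namespace RAMProgram

/-- The program has no loop. -/
def LoopFree : RAMProgram → Prop
  | seq p q => p.LoopFree ∧ q.LoopFree
  | ifLT _ _ p q => p.LoopFree ∧ q.LoopFree
  | whileLT _ _ _ => False
  | _ => True

/-- The final state of a program without loops; loops are ignored. -/
def eval : RAMProgram → RAMState → RAMState
  | skip, s => s
  | const x k, s => s.setReg x k
  | copy x y, s => s.setReg x (s.reg y)
  | succ x y, s => s.setReg x (s.reg y + 1)
  | pred x y, s => s.setReg x (s.reg y - 1)
  | load x a i j, s => s.setReg x (s.arr a (s.reg i) (s.reg j))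
  | store a i j x, s => s.setArr a (s.reg i) (s.reg j) (s.reg x)
  | seq p q, s => q.eval (p.eval s)
  | ifLT x y p q, s => if s.reg x < s.reg y then p.eval s else q.eval s
  | whileLT _ _ _, s => s

/-- A bound for the number of steps of a program without loops. -/
def cost : RAMProgram → ℕ
  | seq p q => p.cost + q.cost
  | ifLT _ _ p q => max p.cost q.cost + 1
  | _ => 1

theorem exec_eval {p : RAMProgram} (hp : p.LoopFree) (s : RAMState) :
    ∃ t ≤ p.cost, p.Exec s t (p.eval s) := by
  induction p generalizing s with
  | seq p q ihp ihq =>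
    obtain ⟨t, ht, h⟩ := ihp hp.1 s
    obtain ⟨t', ht', h'⟩ := ihq hp.2 (p.eval s)
    exact ⟨t + t', Nat.add_le_add ht ht', h.seq h'⟩
  | ifLT x y p q ihp ihq =>
    by_cases hxy : s.reg x < s.reg y
    · obtain ⟨t, ht, h⟩ := ihp hp.1 s
      refine ⟨t + 1, by simp only [cost]; omega, ?_⟩
      simp only [eval, if_pos hxy]
      exact h.ifTrue hxy
    · obtain ⟨t, ht, h⟩ := ihq hp.2 s
      refine ⟨t + 1, by simp only [cost]; omega, ?_⟩
      simp only [eval, if_neg hxy]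
      exact h.ifFalse hxy
  | whileLT => exact hp.elim
  | _ => exact ⟨1, le_rfl, by constructor⟩

/-- The rule for loops: `I a` is the invariant, for a parameter `a` that may change in each round,
and the time of each round is paid by the decrease of the potential `Φ`. -/
theorem exec_while {α : Type*} {x y : ℕ} {p : RAMProgram} (I : α → RAMState → Prop) (Φ : α → ℕ)
    (hb : ∀ a s, I a s → s.reg x < s.reg y →
      ∃ t s' b, p.Exec s t s' ∧ I b s' ∧ t + 1 + Φ b ≤ Φ a) (a : α) (s : RAMState) (h : I a s) :
    ∃ t s' b, (whileLT x y p).Exec s t s' ∧ I b s' ∧ ¬ s'.reg x < s'.reg y ∧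
      t + Φ b ≤ Φ a + 1 := by
  induction hk : Φ a using Nat.strong_induction_on generalizing a s with
  | _ k ih =>
    subst hk
    by_cases hxy : s.reg x < s.reg y
    · obtain ⟨t, s', b, he, hI, ht⟩ := hb a s h hxy
      obtain ⟨t', s'', c, he', hI', hn, ht'⟩ := ih (Φ b) (by omega) b s' hI rfl
      exact ⟨t + t' + 1, s'', c, .whileTrue hxy he he', hI', hn, by omega⟩
    · exact ⟨1, s, a, .whileFalse hxy, h, hxy, by omega⟩

/-- `if x = y then p else q` -/
def ifEq (x y : ℕ) (p q : RAMProgram) : RAMProgram := ifLT x y q (ifLT y x q p)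

theorem eval_ifEq (x y : ℕ) (p q : RAMProgram) (s : RAMState) :
    (ifEq x y p q).eval s = if s.reg x = s.reg y then p.eval s else q.eval s := by
  simp only [ifEq, eval]
  rcases lt_trichotomy (s.reg x) (s.reg y) with h | h | h
  · simp [h, h.ne]
  · simp [h]
  · simp [h, h.ne', h.not_gt]

end RAMProgram

/-! ### The representation of the proposal process in the machine

Arrays are read and written in column 0, except for the arrays 0, 3 and 8, which have a row for each
man or woman. Array 5 holds the men held by the women (`n` for none), array 6 the classes, array 7
the positions of the men, array 8 marks rejected and blacklisted men. Array 9 contains the number of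
cells of a row of array 3 that are not yet written: the men rejected by a woman are written to the
end of her final list one after the other, from right to left. -/

/-- The memory contains the proposal state `σ`, the man `i` of `σ` being the man `μ i` of the
input. Registers 0, 1, 2 hold `n`, `0`, `1`. -/
structure Represents {n : ℕ} (P : Profile (Fin n) (Fin n)) (μ : Fin n ≃ Fin n)
    (σ : ProposalState (Fin n)) (s : RAMState) : Prop where
  size : s.reg 0 = n
  zero : s.reg 1 = 0
  one : s.reg 2 = 1
  list : ∀ (i : Fin n) (j : ℕ) (w : Fin n), (P i).toList[j]? = some w → s.arr 0 (μ i) j = w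
  partner : ∀ i : Fin n, s.arr 2 i 0 = μ i
  hold : ∀ w : Fin n, s.arr 5 w 0 = (σ.hold w).elim n Fin.val
  lab : ∀ w : Fin n, s.arr 6 w 0 = σ.lab w
  ptr : ∀ i : Fin n, s.arr 7 i 0 = σ.ptr i
  mark : ∀ w i : Fin n, s.arr 8 w i = if i ∈ σ.log w ∨ i ∈ σ.bl w then 1 else 0
  slots : ∀ w : Fin n, s.arr 9 w 0 + (σ.log w).length + (σ.bl w).card = n
  length : ∀ w : Fin n, s.arr 4 w 0 + (σ.bl w).card = n
  out : ∀ (w : Fin n) (k : ℕ) (hk : k < (σ.log w).length),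
    s.arr 3 w (s.arr 9 w 0 + k) = μ (σ.log w)[k]

namespace ProposalState

/-- Change the proposal held by `w`. -/
def setHold {V : Type*} [DecidableEq V] (σ : ProposalState V) (w : V) (o : Option V) :
    ProposalState V :=
  { σ with hold := Function.update σ.hold w o }

/-- Merge the class with root `x` into the class with root `y`. -/
def relabel {V : Type*} [DecidableEq V] (σ : ProposalState V) (x y : V) : ProposalState V :=
  { σ with lab := fun v => if σ.lab v = x then y else σ.lab v }

end ProposalState

namespace Represents

open RAMState

variable {n : ℕ} {P : Profile (Fin n) (Fin n)} {μ : Fin n ≃ Fin n} {σ : ProposalState (Fin n)}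
  {s : RAMState}

theorem setReg (h : Represents P μ σ s) {x : ℕ} (hx : 2 < x) (v : ℕ) :
    Represents P μ σ (s.setReg x v) where
  __ := h
  size := by rw [setReg_reg, if_neg (by omega), h.size]
  zero := by rw [setReg_reg, if_neg (by omega), h.zero]
  one := by rw [setReg_reg, if_neg (by omega), h.one]

theorem setHold (h : Represents P μ σ s) (w : Fin n) (o : Option (Fin n)) :
    Represents P μ (σ.setHold w o) (s.setArr 5 w 0 (o.elim n Fin.val)) where
  __ := h
  hold := by
    intro u
    by_cases hu : u = w
    · subst hu
      simp [setArr_arr, ProposalState.setHold]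
    · simpa [setArr_arr, ProposalState.setHold, hu, Fin.val_inj] using h.hold u

theorem setLab (h : Represents P μ σ s) (v l : Fin n) :
    Represents P μ { σ with lab := Function.update σ.lab v l } (s.setArr 6 v 0 l) where
  __ := h
  lab := by
    intro u
    by_cases hu : u = v
    · subst hu
      simp [setArr_arr]
    · simpa [setArr_arr, hu, Fin.val_inj] using h.lab u

/-- There is room for another rejected man. -/
theorem slots_pos (h : Represents P μ σ s) (hσ : σ.Inv P) {w x : Fin n} (hl : x ∉ σ.log w)
    (hb : x ∉ σ.bl w) : 0 < s.arr 9 w 0 := by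
  have h1 := h.slots w
  have h2 : (insert x ((σ.log w).toFinset ∪ σ.bl w)).card ≤ n := by
    simpa using Finset.card_le_univ (insert x ((σ.log w).toFinset ∪ σ.bl w))
  rw [Finset.card_insert_of_notMem (by simp [hl, hb]), Finset.card_union_of_disjoint
    (Finset.disjoint_left.2 fun i hi => hσ.log_bl w i (by simpa using hi)),
    List.toFinset_card_of_nodup (hσ.log_nodup w)] at h2
  omega

theorem drop (h : Represents P μ σ s) {w x : Fin n} (hpos : 0 < s.arr 9 w 0) :
    Represents P μ (σ.drop w x)
      ((((s.setArr 9 w 0 (s.arr 9 w 0 - 1)).setArr 3 w (s.arr 9 w 0 - 1) (μ x)).setArr 8 w x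
        1).setArr 7 x 0 (s.arr 7 x 0 + 1)) where
  __ := h
  ptr := by
    intro i
    by_cases hi : i = x
    · subst hi
      simp [setArr_arr, ProposalState.drop, h.ptr]
    · simpa [setArr_arr, ProposalState.drop, hi, Fin.val_inj] using h.ptr i
  mark := by
    intro u i
    by_cases hu : u = w
    · subst hu
      by_cases hi : i = x
      · simp [setArr_arr, ProposalState.drop, hi]
      · simpa [setArr_arr, ProposalState.drop, hi, Fin.val_inj] using h.mark u i
    · simpa [setArr_arr, ProposalState.drop, hu, Fin.val_inj] using h.mark u i
  slots := by
    intro u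
    by_cases hu : u = w
    · subst hu
      have := h.slots u
      simp [setArr_arr, ProposalState.drop]
      omega
    · simpa [setArr_arr, ProposalState.drop, hu, Fin.val_inj] using h.slots u
  length := by
    intro u
    simpa [setArr_arr, ProposalState.drop] using h.length u
  out := by
    intro u k hk
    by_cases hu : u = w
    · subst hu
      rcases k with _ | k
      · simp [setArr_arr, ProposalState.drop]
      · have hk' : k < (σ.log u).length := by simpa [ProposalState.drop] using hk
        have h1 : s.arr 9 u 0 - 1 + (k + 1) = s.arr 9 u 0 + k := by omega
        have h2 : s.arr 9 u 0 + k ≠ s.arr 9 u 0 - 1 := by omega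
        simpa [setArr_arr, ProposalState.drop, h1, h2] using h.out u k hk'
    · have hk' : k < (σ.log u).length := by simpa [ProposalState.drop, hu] using hk
      simpa [setArr_arr, ProposalState.drop, hu, Fin.val_inj] using h.out u k hk'

theorem ban (h : Represents P μ σ s) {w x : Fin n} (hlog : σ.log w = []) (hx : x ∉ σ.bl w)
    (hpos : 0 < s.arr 9 w 0) :
    Represents P μ (σ.ban w x)
      ((((s.setArr 9 w 0 (s.arr 9 w 0 - 1)).setArr 4 w 0 (s.arr 4 w 0 - 1)).setArr 8 w x
        1).setArr 7 x 0 (s.arr 7 x 0 + 1)) where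
  __ := h
  ptr := by
    intro i
    by_cases hi : i = x
    · subst hi
      simp [setArr_arr, ProposalState.ban, h.ptr]
    · simpa [setArr_arr, ProposalState.ban, hi, Fin.val_inj] using h.ptr i
  mark := by
    intro u i
    by_cases hu : u = w
    · subst hu
      by_cases hi : i = x
      · simp [setArr_arr, ProposalState.ban, hi]
      · simpa [setArr_arr, ProposalState.ban, hi, Fin.val_inj] using h.mark u i
    · simpa [setArr_arr, ProposalState.ban, hu, Fin.val_inj] using h.mark u i
  slots := by
    intro u
    by_cases hu : u = w
    · subst hu
      have := h.slots u
      simp [setArr_arr, ProposalState.ban, hx]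
      omega
    · simpa [setArr_arr, ProposalState.ban, hu, Fin.val_inj] using h.slots u
  length := by
    intro u
    by_cases hu : u = w
    · subst hu
      have h1 := h.length u
      have h2 := h.slots u
      rw [hlog] at h2
      simp [setArr_arr, ProposalState.ban, hx] at h2 ⊢
      omega
    · simpa [setArr_arr, ProposalState.ban, hu, Fin.val_inj] using h.length u
  out := by
    intro u k hk
    have hk' : k < (σ.log u).length := hk
    by_cases hu : u = w
    · subst hu
      simp [hlog] at hk'
    · simpa [setArr_arr, ProposalState.ban, hu, Fin.val_inj] using h.out u k hk'

end Represents

namespace RAMProgram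

open RAMState

variable {n : ℕ} {P : Profile (Fin n) (Fin n)} {μ : Fin n ≃ Fin n} {σ : ProposalState (Fin n)}
  {s : RAMState}

/-- The woman in register `x` rejects the man in register `y`. -/
def dropCode (x y : ℕ) : RAMProgram :=
  seq (load 15 9 x 1) <| seq (pred 15 15) <| seq (store 9 x 1 15) <|
  seq (load 16 2 y 1) <| seq (store 3 x 15 16) <| seq (store 8 x y 2) <|
  seq (load 15 7 y 1) <| seq (succ 15 15) <| store 7 y 1 15

/-- The woman in register `x` blacklists the man in register `y`. -/
def banCode (x y : ℕ) : RAMProgram :=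
  seq (load 15 9 x 1) <| seq (pred 15 15) <| seq (store 9 x 1 15) <|
  seq (load 15 4 x 1) <| seq (pred 15 15) <| seq (store 4 x 1 15) <| seq (store 8 x y 2) <|
  seq (load 15 7 y 1) <| seq (succ 15 15) <| store 7 y 1 15

theorem represents_dropCode (h : Represents P μ σ s) {w i : Fin n} {x y : ℕ}
    (hx : x < 15) (hy : y < 15) (hw : s.reg x = w) (hi : s.reg y = i)
    (hpos : 0 < s.arr 9 w 0) :
    Represents P μ (σ.drop w i) ((dropCode x y).eval s) ∧
      ∀ z < 15, ((dropCode x y).eval s).reg z = s.reg z := by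
  have h15 : ∀ z, z < 15 → z ≠ 15 ∧ z ≠ 16 := fun z hz => by omega
  constructor
  · have h1 := h.drop (w := w) (x := i) hpos
    simp only [dropCode, eval, setReg_reg, setArr_reg, setReg_setArr, setReg_arr, hw, hi, h.zero,
      h.one, (h15 x hx).1, (h15 x hx).2, (h15 y hy).1, (h15 y hy).2, if_false, if_true,
      setArr_arr, h.partner, Nat.reduceEqDiff, false_and, OfNat.one_ne_ofNat]
    exact ((((h1.setReg (by norm_num) _).setReg (by norm_num) _).setReg (by norm_num) _).setReg
      (by norm_num) _).setReg (by norm_num) _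
  · intro z hz
    simp [dropCode, eval, (h15 z hz).1, (h15 z hz).2]

theorem represents_banCode (h : Represents P μ σ s) {w i : Fin n} {x y : ℕ}
    (hx : x < 15) (hy : y < 15) (hw : s.reg x = w) (hi : s.reg y = i) (hlog : σ.log w = [])
    (hb : i ∉ σ.bl w) (hpos : 0 < s.arr 9 w 0) :
    Represents P μ (σ.ban w i) ((banCode x y).eval s) ∧
      ∀ z < 15, ((banCode x y).eval s).reg z = s.reg z := by
  have h15 : ∀ z, z < 15 → z ≠ 15 ∧ z ≠ 16 := fun z hz => by omega
  constructor
  · have h1 := h.ban (w := w) (x := i) hlog hb hpos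
    simp only [banCode, eval, setReg_reg, setArr_reg, setReg_setArr, setReg_arr, hw, hi, h.zero,
      h.one, (h15 x hx).1, (h15 y hy).1, if_false, if_true, setArr_arr,
      Nat.reduceEqDiff, false_and, OfNat.one_ne_ofNat]
    exact (((((h1.setReg (by norm_num) _).setReg (by norm_num) _).setReg (by norm_num) _).setReg
      (by norm_num) _).setReg (by norm_num) _).setReg (by norm_num) _
  · intro z hz
    simp [banCode, eval, (h15 z hz).1]

/-- Merge the class with the root in register 12 into the class with the root in register 11,
starting with the woman in register 14. -/
def relabelCode : RAMProgram :=
  whileLT 14 0 <|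
    seq (load 15 6 14 1) <| seq (ifEq 15 12 (store 6 14 1 11) skip) <| succ 14 14

theorem exec_relabelCode (h : Represents P μ σ s) {x y : Fin n} (hx : s.reg 12 = x)
    (hy : s.reg 11 = y) (h14 : s.reg 14 = 0) :
    ∃ t s', relabelCode.Exec s t s' ∧ Represents P μ (σ.relabel x y) s' ∧
      (∀ z < 11, s'.reg z = s.reg z) ∧ t ≤ 9 * n + 1 := by
  let τ : ℕ → ProposalState (Fin n) := fun k =>
    { σ with lab := fun v => if (v : ℕ) < k ∧ σ.lab v = x then y else σ.lab v }
  obtain ⟨t, s', k, he, ⟨h1, h2, h3, h4, h5⟩, h6, h7⟩ := exec_while (x := 14) (y := 0)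
    (p := seq (load 15 6 14 1) <| seq (ifEq 15 12 (store 6 14 1 11) skip) <| succ 14 14)
    (fun k s' => k ≤ n ∧ Represents P μ (τ k) s' ∧ s'.reg 14 = k ∧
      (∀ z < 11, s'.reg z = s.reg z) ∧ s'.reg 12 = x ∧ s'.reg 11 = y)
    (fun k => 9 * (n - k)) (by
      rintro k s' ⟨h1, h2, h3, h4, h5, h6⟩ hlt
      rw [h2.size, h3] at hlt
      obtain ⟨t, ht, he⟩ := exec_eval
        (p := seq (load 15 6 14 1) <| seq (ifEq 15 12 (store 6 14 1 11) skip) <| succ 14 14)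
        (by simp [LoopFree, ifEq]) s'
      refine ⟨t, _, k + 1, he, ⟨hlt, ?_⟩, by simp [cost, ifEq] at ht; omega⟩
      have hl : s'.arr 6 k 0 = σ.lab ⟨k, hlt⟩ := by
        have := h2.lab ⟨k, hlt⟩
        simpa [τ] using this
      by_cases hk : σ.lab ⟨k, hlt⟩ = x
      · have hτ : τ (k + 1) = { τ k with lab := Function.update (τ k).lab ⟨k, hlt⟩ y } := by
          simp only [τ]
          congr 1
          funext v
          by_cases hv : v = ⟨k, hlt⟩
          · subst hv
            simp [hk]
          · have : (v : ℕ) ≠ k := fun hc => hv (Fin.ext hc)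
            have : (v : ℕ) < k + 1 ↔ (v : ℕ) < k := by omega
            simp [Function.update_of_ne hv, this]
        have h7 := h2.setLab ⟨k, hlt⟩ y
        rw [← hτ] at h7
        simp only [eval, eval_ifEq, setReg_reg, h3, h2.zero, hl, h5, hk, h6,
          setReg_setArr, setArr_reg, Nat.reduceEqDiff, reduceIte, OfNat.one_ne_ofNat]
        refine ⟨(h7.setReg (by norm_num) _).setReg (by norm_num) _, trivial, fun z hz => ?_,
          trivial, trivial⟩
        rw [if_neg (by omega), if_neg (by omega), h4 z hz]
      · have hτ : τ (k + 1) = τ k := by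
          simp only [τ]
          congr 1
          funext v
          by_cases hv : v = ⟨k, hlt⟩
          · subst hv
            simp [hk]
          · have : (v : ℕ) ≠ k := fun hc => hv (Fin.ext hc)
            have : (v : ℕ) < k + 1 ↔ (v : ℕ) < k := by omega
            simp [this]
        have hk' : (σ.lab ⟨k, hlt⟩ : ℕ) ≠ x := fun hc => hk (Fin.ext hc)
        rw [hτ]
        simp only [eval, eval_ifEq, setReg_reg, h3, h2.zero, hl, h5, h6, hk', Nat.reduceEqDiff,
          reduceIte]
        refine ⟨(h2.setReg (by norm_num) _).setReg (by norm_num) _, trivial, fun z hz => ?_,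
          trivial, trivial⟩
        rw [if_neg (by omega), if_neg (by omega), h4 z hz]) 0 s
    ⟨Nat.zero_le _, by simpa [τ] using h, h14, fun _ _ => rfl, hx, hy⟩
  refine ⟨t, s', he, ?_, h4, by omega⟩
  have hk : k = n := by
    rw [h2.size, h3] at h6
    omega
  subst hk
  simpa [τ, ProposalState.relabel] using h2

theorem exec_relabelCode_of_eq (h : s.reg 14 = s.reg 0) : relabelCode.Exec s 1 s :=
  .whileFalse (by simp [h])

end RAMProgram

/-! ### Chains of proposals -/

namespace ProposalState

section Chain

variable {n : ℕ}

/-- The invariant of a chain of proposals. The chain is over if `c ≠ 0`; otherwise `a` is the man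
who makes the next proposal. Besides him, the men in `F` are free. In the first stage, `st = 0`,
nobody has been blacklisted. In the second stage, `i` is the only woman who may be free, and the
roots that were dealt with before are matched as intended. -/
structure Chain (P : Profile (Fin n) (Fin n)) (st i : ℕ) (F : Set (Fin n))
    (σ : ProposalState (Fin n)) (a : Fin n) (c : ℕ) : Prop where
  inv : σ.Inv P
  free : ∀ j, σ.Free j ↔ (c = 0 ∧ j = a) ∨ j ∈ F
  notMem : c = 0 → a ∉ F
  first : st = 0 → ∀ w, σ.bl w = ∅
  second : st ≠ 0 → ∀ w, σ.hold w = none → c = 0 ∧ (w : ℕ) = i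
  done : st ≠ 0 → ∀ j : Fin n, ((j : ℕ) < i ∨ ((j : ℕ) = i ∧ c ≠ 0)) → σ.lab j = j →
    σ.hold j = some j

variable {P : Profile (Fin n) (Fin n)} {st i : ℕ} {F : Set (Fin n)} {σ : ProposalState (Fin n)}
  {a w b : Fin n}

theorem Inv.free_assign (h : σ.Inv P) (j : Fin n) :
    (σ.assign w a).Free j ↔ j ≠ a ∧ (σ.Free j ∨ σ.hold w = some j) := by
  constructor
  · intro hj
    have h1 : ∀ u, (if u = w then some a else σ.hold u) ≠ some j := by
      simpa [Free, ProposalState.assign, Function.update_apply] using hj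
    refine ⟨fun hja => h1 w (by simp [hja]), ?_⟩
    by_contra! hc
    obtain ⟨h2, h3⟩ := hc
    obtain ⟨u, hu⟩ : ∃ u, σ.hold u = some j := by simpa [Free] using h2
    have huw : u ≠ w := by rintro rfl; exact h3 hu
    exact h1 u (by simpa [huw] using hu)
  · rintro ⟨hja, hj⟩ u hu
    have h1 : (if u = w then some a else σ.hold u) = some j := by
      simpa [ProposalState.assign, Function.update_apply] using hu
    split_ifs at h1 with huw
    · exact hja (Option.some.inj h1).symm
    · exact hj.elim (fun h2 => h2 u h1) (fun h2 => huw (h.inj u w j h1 h2))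

theorem Chain.isFree (h : Chain P st i F σ a 0) : σ.Free a := (h.free a).2 (Or.inl ⟨rfl, rfl⟩)

/-- A woman rejects the man whom she holds for the one who proposes to her. -/
theorem Chain.swap (h : Chain P st i F σ a 0) (hn : (P a).toList[σ.ptr a]? = some w)
    (hb : σ.hold w = some b) (hbw : b ≠ w)
    (hc : w = a ∨ (σ.hold (σ.lab w) ≠ none ∧ σ.lab w ≠ σ.lab a)) :
    Chain P st i F ((σ.assign w a).drop w b) b 0 := by
  have hba : b ≠ a := by rintro rfl; exact h.isFree w hb
  have hinv := h.inv.assign h.isFree hn (by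
    rcases hc with hc | hc
    · exact Or.inl hc
    · exact Or.inr (Or.inr ⟨hc.1, hc.2, by simpa [hb] using hbw⟩))
  have hfree : ∀ j, (σ.assign w a).Free j ↔ j = b ∨ j ∈ F := by
    intro j
    rw [h.inv.free_assign, h.free, hb]
    have h1 := h.notMem rfl
    have h2 : b ∉ F := fun hbF => (h.free b).2 (Or.inr hbF) w hb
    constructor
    · rintro ⟨hja, (⟨-, hj⟩ | hj) | hj⟩
      · exact absurd hj hja
      · exact Or.inr hj
      · exact Or.inl (Option.some.inj hj).symm
    · rintro (rfl | hj)
      · exact ⟨hba, Or.inr rfl⟩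
      · exact ⟨by rintro rfl; exact h1 hj, Or.inl (Or.inr hj)⟩
  have hold : ∀ u, u ≠ w → (σ.assign w a).hold u = σ.hold u := fun u hu => by
    simp [ProposalState.assign, hu]
  have hold_w : (σ.assign w a).hold w = some a := by simp [ProposalState.assign]
  refine ⟨hinv.drop ((hfree b).2 (Or.inl rfl)) (h.inv.next w b hb) hbw (by simp [hold_w]) ?_,
    fun j => (hfree j).trans (by simp), ?_, h.first, fun hst u hu => ?_, fun hst j hj hl => ?_⟩
  · rcases hc with rfl | ⟨h1, h2⟩
    · exact Or.inl hold_w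
    · right
      simp only [ProposalState.assign, if_true]
      intro h3
      rw [← h3, h.inv.lab_idem] at h2
      exact h2 rfl
  · exact fun _ hbF => (h.free b).2 (Or.inr hbF) w hb
  · have huw : u ≠ w := by
      rintro rfl
      exact absurd (hold_w.symm.trans hu) (by simp)
    exact h.second hst u ((hold u huw).symm.trans hu)
  · have h1 := h.done hst j hj (h.inv.lab_root_of_assign hl)
    have hjw : j ≠ w := by
      rintro rfl
      rw [hb] at h1
      exact hbw (Option.some.inj h1)
    exact (hold j hjw).trans h1

/-- The chain ends with a free woman who holds the man who proposes to her. -/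
theorem Chain.finish (h : Chain P st i F σ a 0) (hn : (P a).toList[σ.ptr a]? = some w)
    (hw : σ.hold w = none) (hc : w = a ∨ st = 0) : Chain P st i F (σ.assign w a) a 1 := by
  have hinv := h.inv.assign h.isFree hn (by
    rcases hc with hc | hc
    · exact Or.inl hc
    · exact Or.inr (Or.inl ⟨hw, h.first hc w⟩))
  have hold : ∀ u, u ≠ w → (σ.assign w a).hold u = σ.hold u := fun u hu => by
    simp [ProposalState.assign, hu]
  have hold_w : (σ.assign w a).hold w = some a := by simp [ProposalState.assign]
  refine ⟨hinv, fun j => ?_, by simp, h.first, fun hst u hu => ?_, fun hst j hj hl => ?_⟩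
  · rw [h.inv.free_assign, h.free, hw]
    have h1 := h.notMem rfl
    constructor
    · rintro ⟨hja, (⟨-, hj⟩ | hj) | hj⟩
      · exact absurd hj hja
      · exact Or.inr hj
      · simp at hj
    · rintro (⟨h2, -⟩ | hj)
      · simp at h2
      · exact ⟨by rintro rfl; exact h1 hj, Or.inl (Or.inr hj)⟩
  · have huw : u ≠ w := by
      rintro rfl
      exact absurd (hold_w.symm.trans hu) (by simp)
    exact absurd (Fin.ext ((h.second hst u ((hold u huw).symm.trans hu)).2.trans
      (h.second hst w hw).2.symm)) huw
  · obtain rfl := hc.resolve_right hst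
    by_cases hjw : j = w
    · rw [hjw]
      exact hold_w
    · rw [hold j hjw]
      have := (h.second hst w hw).2
      have hji : (j : ℕ) ≠ i := fun hji => hjw (Fin.ext (hji.trans this.symm))
      exact h.done hst j (Or.inl (hj.resolve_right fun h => hji h.1))
        (h.inv.lab_root_of_assign hl)

/-- A woman rejects the man who proposes to her for the one whom she holds. -/
theorem Chain.reject (h : Chain P st i F σ a 0) (hn : (P a).toList[σ.ptr a]? = some w)
    (hwa : w ≠ a) (hb : σ.hold w = some b)
    (hc : b = w ∨ σ.lab w = σ.lab a ∨ σ.hold (σ.lab w) = none) :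
    Chain P st i F (σ.drop w a) a 0 := by
  refine ⟨h.inv.drop h.isFree hn hwa.symm (by simp [hb]) ?_, h.free, h.notMem, h.first, h.second,
    h.done⟩
  rcases hc with rfl | hc | hc
  · exact Or.inl hb
  · right
    intro h1
    have h2 := h.inv.hold_lab_of_free h.isFree
    rw [← hc, h1, hb] at h2
    simp at h2
  · right
    intro h1
    rw [h1, hb] at hc
    simp at hc

/-- In the second stage, the free woman blacklists the man who proposes to her. -/
theorem Chain.ban (h : Chain P st i F σ a 0) (hn : (P a).toList[σ.ptr a]? = some w)
    (hwa : w ≠ a) (hw : σ.hold w = none) (hst : st ≠ 0) : Chain P st i F (σ.ban w a) a 0 := by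
  refine ⟨h.inv.ban h.isFree hn hwa.symm hw (Fin.ext ?_), h.free, h.notMem,
    fun h0 => absurd h0 hst, h.second, h.done⟩
  exact (h.second hst _ (h.inv.hold_lab_of_free h.isFree)).2.trans (h.second hst w hw).2.symm

/-- The number of list positions ahead of the men. -/
def pending (σ : ProposalState (Fin n)) : ℕ := ∑ i, (n - σ.ptr i)

/-- The number of classes. -/
def numClasses (σ : ProposalState (Fin n)) : ℕ := (Finset.univ.filter fun r => σ.lab r = r).card

theorem Inv.ptr_lt_size (h : σ.Inv P) (hP : ∀ i, i ∈ (P i).toList) (x : Fin n) : σ.ptr x < n :=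
  (h.ptr_lt hP x).trans_le (by simpa using (P x).nodup.length_le_card)

theorem sum_update_succ {f : Fin n → ℕ} {x : Fin n} (hx : f x < n) :
    ∑ i, (n - Function.update f x (f x + 1) i) + 1 = ∑ i, (n - f i) := by
  rw [← Finset.add_sum_erase _ _ (Finset.mem_univ x),
    ← Finset.add_sum_erase (f := fun i => n - f i) _ (Finset.mem_univ x)]
  have : ∑ i ∈ Finset.univ.erase x, (n - Function.update f x (f x + 1) i) =
      ∑ i ∈ Finset.univ.erase x, (n - f i) :=
    Finset.sum_congr rfl fun i hi => by rw [Function.update_of_ne (Finset.ne_of_mem_erase hi)]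
  rw [this, Function.update_self]
  omega

theorem pending_drop (hx : σ.ptr a < n) : (σ.drop w a).pending + 1 = σ.pending :=
  sum_update_succ hx

theorem pending_ban (hx : σ.ptr a < n) : (σ.ban w a).pending + 1 = σ.pending :=
  sum_update_succ hx

theorem Inv.numClasses_assign_le (h : σ.Inv P) : (σ.assign w a).numClasses ≤ σ.numClasses :=
  Finset.card_le_card fun r hr => by
    simp only [Finset.mem_filter, Finset.mem_univ, true_and] at hr ⊢
    exact h.lab_root_of_assign hr

theorem Inv.numClasses_assign_lt (h : σ.Inv P) (hl : σ.lab w ≠ σ.lab a) :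
    (σ.assign w a).numClasses < σ.numClasses := by
  refine Finset.card_lt_card (Finset.ssubset_iff_of_subset (fun r hr => ?_) |>.2
    ⟨σ.lab w, ?_, ?_⟩)
  · simp only [Finset.mem_filter, Finset.mem_univ, true_and] at hr ⊢
    exact h.lab_root_of_assign hr
  · simpa using h.lab_idem w
  · intro hc
    have h1 := (Finset.mem_filter.1 hc).2
    simp only [ProposalState.assign, h.lab_idem, if_true] at h1
    exact hl h1.symm

end Chain

end ProposalState

/-! ### The program for a chain of proposals -/

namespace RAMProgram

open RAMState

variable {n : ℕ} {P : Profile (Fin n) (Fin n)} {μ : Fin n ≃ Fin n} {σ : ProposalState (Fin n)}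
  {s : RAMState}

/-- For the man in register 5, load the woman `w` whom he addresses into register 7, the man held
by `w` into register 10, the classes of the man and of `w` into registers 11 and 12, and the man
held by the root of the class of `w` into register 13. -/
def chainLoad : RAMProgram :=
  seq (copy 14 0) <| seq (load 8 2 5 1) <| seq (load 9 7 5 1) <| seq (load 7 0 8 9) <|
  seq (load 10 5 7 1) <| seq (load 11 6 5 1) <| seq (load 12 6 7 1) <| load 13 5 12 1

/-- The reaction of the woman in register 7. Register 6 becomes `1` when the chain is over, and
register 14 becomes `0` when two classes have to be merged. Register 3 is `0` in the first stage
and `1` in the second. -/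
def chainDecide : RAMProgram :=
  ifEq 7 5
    (seq (store 5 7 1 5) (ifLT 10 0 (seq (dropCode 7 10) (copy 5 10)) (const 6 1)))
    (ifLT 10 0
      (ifEq 10 7 (dropCode 7 5)
        (ifEq 12 11 (dropCode 7 5)
          (ifLT 13 0
            (seq (store 5 7 1 5) (seq (dropCode 7 10) (seq (copy 5 10) (const 14 0))))
            (dropCode 7 5))))
      (ifLT 3 2 (seq (store 5 7 1 5) (seq (const 14 0) (const 6 1))) (banCode 7 5)))

/-- One proposal, and the merging of two classes if it is required. -/
def chainBody : RAMProgram := seq (seq chainLoad chainDecide) relabelCode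

/-- The registers during a chain of proposals, with the meaning that `ProposalState.Chain` gives to
the parameters. -/
structure ChainRegs (st i a c : ℕ) (s : RAMState) : Prop where
  stage : s.reg 3 = st
  outer : s.reg 4 = i
  man : s.reg 5 = a
  halt : s.reg 6 = c

theorem chainLoad_spec (h : Represents P μ σ s) {a w : Fin n} (ha : s.reg 5 = a)
    (hn : (P a).toList[σ.ptr a]? = some w) :
    Represents P μ σ (chainLoad.eval s) ∧ (∀ z < 7, (chainLoad.eval s).reg z = s.reg z) ∧
      (chainLoad.eval s).reg 7 = w ∧ (chainLoad.eval s).reg 10 = (σ.hold w).elim n Fin.val ∧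
      (chainLoad.eval s).reg 11 = σ.lab a ∧ (chainLoad.eval s).reg 12 = σ.lab w ∧
      (chainLoad.eval s).reg 13 = (σ.hold (σ.lab w)).elim n Fin.val ∧
      (chainLoad.eval s).reg 14 = n := by
  have hw := h.list a _ w hn
  simp only [chainLoad, eval, setReg_reg, setReg_arr, ha, h.zero, h.partner, h.ptr, hw, h.hold,
    h.lab, h.size, Nat.reduceEqDiff, reduceIte, OfNat.one_ne_ofNat]
  refine ⟨?_, fun z hz => ?_, trivial, trivial, trivial, trivial, trivial, trivial⟩
  · exact (((((((h.setReg (by norm_num) _).setReg (by norm_num) _).setReg (by norm_num) _).setReg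
      (by norm_num) _).setReg (by norm_num) _).setReg (by norm_num) _).setReg (by norm_num)
      _).setReg (by norm_num) _
  · have : z ≠ 7 ∧ z ≠ 8 ∧ z ≠ 9 ∧ z ≠ 10 ∧ z ≠ 11 ∧ z ≠ 12 ∧ z ≠ 13 ∧ z ≠ 14 := by omega
    simp [this]

theorem assign_self_eq_setHold (a : Fin n) : σ.assign a a = σ.setHold a (some a) := by
  have : (fun v => if σ.lab v = σ.lab a then σ.lab a else σ.lab v) = σ.lab := by
    funext v
    split_ifs with hv
    · exact hv.symm
    · rfl
  simp only [ProposalState.assign, ProposalState.setHold, this]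

/-- The loop invariant of a chain of proposals. -/
def ChainState (P : Profile (Fin n) (Fin n)) (μ : Fin n ≃ Fin n) (st i : ℕ) (F : Set (Fin n))
    (σ : ProposalState (Fin n)) (a : Fin n) (c : ℕ) (s : RAMState) : Prop :=
  ProposalState.Chain P st i F σ a c ∧ Represents P μ σ s ∧ ChainRegs st i a c s

/-- The time still available for a chain of proposals and all later ones. Relabelling is paid for
by the number of classes, or by the end of the chain. -/
def potential (σ : ProposalState (Fin n)) : ℕ :=
  50 * σ.pending + (9 * n + 50) * σ.numClasses

theorem exec_chainBody {st i : ℕ} {F : Set (Fin n)} {a : Fin n} (hP : ∀ i, i ∈ (P i).toList)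
    (h : ChainState P μ st i F σ a 0 s) :
    ∃ t s' σ' a' c', chainBody.Exec s t s' ∧ ChainState P μ st i F σ' a' c' s' ∧
      t + 1 + (potential σ' + if c' = 0 then 9 * n + 50 else 0) ≤
        potential σ + (9 * n + 50) := by
  obtain ⟨hC, hR, hG⟩ := h
  obtain ⟨w, hn⟩ := hC.inv.exists_next hP a
  obtain ⟨hal, hab⟩ := hC.inv.notMem_of_next hn
  obtain ⟨hR1, hz, h7, h10, h11, h12, h13, h14⟩ := chainLoad_spec hR hG.man hn
  obtain ⟨t, ht, he⟩ := exec_eval (p := seq chainLoad chainDecide)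
    (by simp [LoopFree, chainLoad, chainDecide, ifEq, dropCode, banCode]) s
  replace ht : t ≤ 40 := ht.trans (by decide)
  simp only [eval] at he
  set s1 := chainLoad.eval s with hs1
  have h5 : s1.reg 5 = a := (hz 5 (by norm_num)).trans hG.man
  have h3 : s1.reg 3 = st := (hz 3 (by norm_num)).trans hG.stage
  have h4 : s1.reg 4 = i := (hz 4 (by norm_num)).trans hG.outer
  have h6 : s1.reg 6 = 0 := (hz 6 (by norm_num)).trans hG.halt
  have hptr := fun x => hC.inv.ptr_lt_size hP x
  -- the cases that do not merge classes, and below the cases that do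
  have stay : ∀ σ' (a' : Fin n) c', (chainDecide.eval s1).reg 14 = n →
      ProposalState.Chain P st i F σ' a' c' → Represents P μ σ' (chainDecide.eval s1) →
      ChainRegs st i a' c' (chainDecide.eval s1) →
      ((potential σ' + if c' = 0 then 9 * n + 50 else 0) + 50 ≤ potential σ + (9 * n + 50)) →
      ∃ t s' σ' a' c', chainBody.Exec s t s' ∧ ChainState P μ st i F σ' a' c' s' ∧
      t + 1 + (potential σ' + if c' = 0 then 9 * n + 50 else 0) ≤
        potential σ + (9 * n + 50) := fun σ' a' c' hr h1 h2 h3 hp =>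
    ⟨_, _, σ', a', c', he.seq (exec_relabelCode_of_eq (by rw [hr, h2.size])), ⟨h1, h2, h3⟩,
      by omega⟩
  have merge : ∀ σ' (a' : Fin n) c', (chainDecide.eval s1).reg 14 = 0 →
      (chainDecide.eval s1).reg 11 = σ.lab a → (chainDecide.eval s1).reg 12 = σ.lab w →
      ProposalState.Chain P st i F (σ'.relabel (σ.lab w) (σ.lab a)) a' c' →
      Represents P μ σ' (chainDecide.eval s1) →
      ChainRegs st i a' c' (chainDecide.eval s1) →
      ((potential (σ'.relabel (σ.lab w) (σ.lab a)) + if c' = 0 then 9 * n + 50 else 0) +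
        (9 * n + 50) ≤ potential σ + (9 * n + 50)) →
      ∃ t s' σ' a' c', chainBody.Exec s t s' ∧ ChainState P μ st i F σ' a' c' s' ∧
      t + 1 + (potential σ' + if c' = 0 then 9 * n + 50 else 0) ≤
        potential σ + (9 * n + 50) := by
    intro σ' a' c' hr0 hr1 hr2 h1 h2 h3 hp
    obtain ⟨t', s', he', hR', hz', ht'⟩ := exec_relabelCode h2 hr2 hr1 hr0
    exact ⟨_, s', _, a', c', he.seq he', ⟨h1, hR', (hz' 3 (by norm_num)).trans h3.stage,
      (hz' 4 (by norm_num)).trans h3.outer, (hz' 5 (by norm_num)).trans h3.man,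
      (hz' 6 (by norm_num)).trans h3.halt⟩, by omega⟩
  have hstore : s1.setArr 5 (s1.reg 7) (s1.reg 1) (s1.reg 5) =
      s1.setArr 5 w 0 ((some a).elim n Fin.val) := by rw [h7, h5, hR1.zero]; rfl
  have hR2 := hR1.setHold w (some a)
  by_cases hwa : w = a
  · subst hwa
    rcases hb : σ.hold w with _ | b
    · have heq : chainDecide.eval s1 =
          (s1.setArr 5 w 0 ((some w).elim n Fin.val)).setReg 6 1 := by
        simp only [chainDecide, eval_ifEq, eval, h7, h5, setArr_reg, h10, hb, Option.elim_none,
          hR1.size, hR1.zero, lt_irrefl, if_true, if_false, Option.elim_some]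
      rw [heq] at stay
      refine stay (σ.assign w w) w 1 (by simp [h14]) (hC.finish hn hb (Or.inl rfl)) ?_
        (by constructor <;> simp [h3, h4, h5]) ?_
      · rw [assign_self_eq_setHold]
        exact hR2.setReg (by norm_num) _
      · have h1 : (σ.assign w w).pending = σ.pending := rfl
        have h2 := Nat.mul_le_mul_left (9 * n + 50)
          (hC.inv.numClasses_assign_le (w := w) (a := w))
        simp only [potential, h1, one_ne_zero, if_false]
        omega
    · have hbw : b ≠ w := by rintro rfl; exact hC.isFree b hb
      have hC' := hC.swap hn hb hbw (Or.inl rfl)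
      obtain ⟨hbl, hbb⟩ := hC.inv.notMem_of_next (hC.inv.next w b hb)
      rw [assign_self_eq_setHold] at hC'
      obtain ⟨hR3, hz3⟩ := represents_dropCode (x := 7) (y := 10) (i := b) hR2 (by norm_num)
        (by norm_num) (by simp [h7]) (by simp [h10, hb]) (hR1.slots_pos hC.inv hbl hbb)
      set s2 := (dropCode 7 10).eval (s1.setArr 5 w 0 ((some w).elim n Fin.val)) with hs2
      have heq : chainDecide.eval s1 = s2.setReg 5 (s2.reg 10) := by
        have hlt : (b : ℕ) < n := b.2
        simp only [chainDecide, eval_ifEq, eval, hstore]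
        simp only [h7, h5, setArr_reg, h10, hb, Option.elim_some, hR1.size, if_true, hlt]
        simp only [hs2, Option.elim_some]
      rw [heq] at stay
      refine stay _ b 0 (by simp [hz3, h14]) hC' (hR3.setReg (by norm_num) _)
        (by constructor <;> simp [hz3, h3, h4, h6, h10, hb]) ?_
      have h1 := ProposalState.pending_drop (σ := σ.setHold w (some w)) (w := w) (hptr b)
      have h2 : ((σ.setHold w (some w)).drop w b).numClasses = σ.numClasses := rfl
      have h3 : (σ.setHold w (some w)).pending = σ.pending := rfl
      simp only [potential, h2, if_true]
      omega
  · have hwa' : (w : ℕ) ≠ a := fun hc => hwa (Fin.ext hc)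
    have reject : chainDecide.eval s1 = (dropCode 7 5).eval s1 →
        ProposalState.Chain P st i F (σ.drop w a) a 0 →
        ∃ t s' σ' a' c', chainBody.Exec s t s' ∧ ChainState P μ st i F σ' a' c' s' ∧
        t + 1 + (potential σ' + if c' = 0 then 9 * n + 50 else 0) ≤
          potential σ + (9 * n + 50) := by
      intro heq hC'
      obtain ⟨hR3, hz3⟩ := represents_dropCode (x := 7) (y := 5) (i := a) hR1 (by norm_num)
        (by norm_num) h7 h5 (hR1.slots_pos hC.inv hal hab)
      rw [heq] at stay
      refine stay _ a 0 (by simp [hz3, h14]) hC' hR3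
        (by constructor <;> simp [hz3, h3, h4, h6, h5]) ?_
      have h1 := ProposalState.pending_drop (σ := σ) (w := w) (hptr a)
      have h2 : (σ.drop w a).numClasses = σ.numClasses := rfl
      simp only [potential, h2, if_true]
      omega
    rcases hb : σ.hold w with _ | b
    · by_cases hst : st = 0
      · have heq : chainDecide.eval s1 =
            ((s1.setArr 5 w 0 ((some a).elim n Fin.val)).setReg 14 0).setReg 6 1 := by
          simp only [chainDecide, eval_ifEq, eval, hstore]
          simp only [h7, h5, h10, hb, Option.elim_none, hR1.size, lt_irrefl, if_false, hwa', h3,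
            hst, hR1.one, zero_lt_one, if_true]
        rw [heq] at merge
        refine merge (σ.setHold w (some a)) a 1 (by simp) (by simp [h11]) (by simp [h12])
          (hC.finish hn hb (Or.inr hst)) ((hR2.setReg (by norm_num) _).setReg (by norm_num) _)
          (by constructor <;> simp [h3, h4, h5]) ?_
        have h1 : ((σ.setHold w (some a)).relabel (σ.lab w) (σ.lab a)).pending = σ.pending := rfl
        have h2 : ((σ.setHold w (some a)).relabel (σ.lab w) (σ.lab a)).numClasses ≤
            σ.numClasses := hC.inv.numClasses_assign_le (w := w) (a := a)
        have h3 := Nat.mul_le_mul_left (9 * n + 50) h2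
        simp only [potential, h1, one_ne_zero, if_false]
        omega
      · have heq : chainDecide.eval s1 = (banCode 7 5).eval s1 := by
          have : ¬ st < 1 := by omega
          simp only [chainDecide, eval_ifEq, eval]
          simp only [h7, h5, h10, hb, Option.elim_none, hR1.size, lt_irrefl, if_false, hwa', h3,
            this, hR1.one]
        have hlog : σ.log w = [] :=
          hC.inv.log_root w (hC.inv.free_root w hb) (by simp [hb])
        obtain ⟨hR3, hz3⟩ := represents_banCode (x := 7) (y := 5) (i := a) hR1
          (by norm_num) (by norm_num) h7 h5 hlog hab (hR1.slots_pos hC.inv hal hab)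
        rw [heq] at stay
        refine stay _ a 0 (by simp [hz3, h14]) (hC.ban hn hwa hb hst) hR3
          (by constructor <;> simp [hz3, h3, h4, h6, h5]) ?_
        have h1 := ProposalState.pending_ban (σ := σ) (w := w) (hptr a)
        have h2 : (σ.ban w a).numClasses = σ.numClasses := rfl
        simp only [potential, h2, if_true]
        omega
    · have hlt : (b : ℕ) < n := b.2
      by_cases hbw : b = w
      · refine reject ?_ (hC.reject hn hwa hb (Or.inl hbw))
        simp only [chainDecide, eval_ifEq, eval]
        simp only [h7, h5, h10, hb, Option.elim_some, hR1.size, if_false, hwa', if_true, hbw]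
        simp
      · have hbw' : (b : ℕ) ≠ w := fun hc => hbw (Fin.ext hc)
        by_cases hl : σ.lab w = σ.lab a
        · refine reject ?_ (hC.reject hn hwa hb (Or.inr (Or.inl hl)))
          simp only [chainDecide, eval_ifEq, eval]
          simp only [h7, h5, h10, hb, Option.elim_some, hR1.size, if_false, hwa', hlt, if_true,
            hbw', h11, h12, hl]
        · have hl' : (σ.lab w : ℕ) ≠ σ.lab a := fun hc => hl (Fin.ext hc)
          rcases hr : σ.hold (σ.lab w) with _ | r
          · refine reject ?_ (hC.reject hn hwa hb (Or.inr (Or.inr hr)))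
            simp only [chainDecide, eval_ifEq, eval]
            simp only [h7, h5, h10, hb, Option.elim_some, hR1.size, if_false, hwa', hlt, if_true,
              hbw', h11, h12, hl', h13, hr, Option.elim_none, lt_irrefl]
          · have hrlt : (r : ℕ) < n := r.2
            have hC' := hC.swap hn hb hbw (Or.inr ⟨by simp [hr], hl⟩)
            obtain ⟨hbl, hbb⟩ := hC.inv.notMem_of_next (hC.inv.next w b hb)
            obtain ⟨hR3, hz3⟩ := represents_dropCode (x := 7) (y := 10) (i := b) hR2
              (by norm_num) (by norm_num) (by simp [h7]) (by simp [h10, hb])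
              (hR1.slots_pos hC.inv hbl hbb)
            set s2 := (dropCode 7 10).eval (s1.setArr 5 w 0 ((some a).elim n Fin.val)) with hs2
            have heq : chainDecide.eval s1 = (s2.setReg 5 (s2.reg 10)).setReg 14 0 := by
              simp only [chainDecide, eval_ifEq, eval, hstore]
              simp only [h7, h5, h10, hb, Option.elim_some, hR1.size, if_false, hwa', hlt,
                if_true, hbw', h11, h12, hl', h13, hr, hrlt]
              simp only [hs2, Option.elim_some]
            rw [heq] at merge
            refine merge ((σ.setHold w (some a)).drop w b) b 0 (by simp) (by simp [hz3, h11])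
              (by simp [hz3, h12]) hC' ((hR3.setReg (by norm_num) _).setReg (by norm_num) _)
              (by constructor <;> simp [hz3, h3, h4, h6, h10, hb]) ?_
            have e1 : ((σ.setHold w (some a)).drop w b).relabel (σ.lab w) (σ.lab a) =
              (σ.assign w a).drop w b := rfl
            have e2 : ((σ.assign w a).drop w b).pending + 1 = (σ.assign w a).pending :=
              ProposalState.pending_drop (σ := σ.assign w a) (hptr b)
            have e3 : (σ.assign w a).pending = σ.pending := rfl
            have e4 : ((σ.assign w a).drop w b).numClasses = (σ.assign w a).numClasses := rfl
            have e5 := hC.inv.numClasses_assign_lt hl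
            have e6 := Nat.mul_le_mul_left (9 * n + 50) (Nat.succ_le_of_lt e5)
            rw [Nat.succ_eq_add_one, mul_add] at e6
            simp only [potential, e1, e4, if_true]
            omega

theorem exec_chain {st i : ℕ} {F : Set (Fin n)} {a : Fin n} {c : ℕ}
    (hP : ∀ i, i ∈ (P i).toList) (h : ChainState P μ st i F σ a c s) :
    ∃ t s' σ' a' c', (whileLT 6 2 chainBody).Exec s t s' ∧ c' ≠ 0 ∧
      ChainState P μ st i F σ' a' c' s' ∧
      t + potential σ' ≤ potential σ + (9 * n + 51) := by
  obtain ⟨t, s', ⟨σ', a', c'⟩, he, h1, h2, h3⟩ := exec_while (x := 6) (y := 2) (p := chainBody)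
    (fun (q : ProposalState (Fin n) × Fin n × ℕ) s => ChainState P μ st i F q.1 q.2.1 q.2.2 s)
    (fun q => potential q.1 + if q.2.2 = 0 then 9 * n + 50 else 0) (by
      rintro ⟨σ, a, c⟩ s h hlt
      obtain rfl : c = 0 := by
        have h1 : s.reg 6 = c := h.2.2.halt
        rw [h1, h.2.1.one] at hlt
        omega
      obtain ⟨t, s', σ', a', c', he, h', ht⟩ := exec_chainBody hP h
      exact ⟨t, s', (σ', a', c'), he, h', by simpa using ht⟩) (σ, a, c) s h
  refine ⟨t, s', σ', a', c', he, ?_, h1, ?_⟩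
  · have h4 : s'.reg 6 = c' := h1.2.2.halt
    rw [h4, h1.2.1.one] at h2
    omega
  · simp only at h3
    split_ifs at h3 <;> omega

end RAMProgram

/-! ### The whole algorithm -/

namespace ProposalState

variable {n : ℕ} {P : Profile (Fin n) (Fin n)} {σ : ProposalState (Fin n)}

theorem hold_ne_none (hf : ∀ j, ¬ σ.Free j) (w : Fin n) : σ.hold w ≠ none := by
  have h1 : ∀ j, ∃ u, σ.hold u = some j := by simpa [Free] using hf
  choose g hg using h1
  have hinj : Function.Injective g := fun i j hij => by
    have := hg j
    rw [← hij, hg i] at this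
    exact Option.some.inj this
  obtain ⟨j, rfl⟩ := (Finite.injective_iff_surjective.1 hinj) w
  simp [hg]

/-- The beginning of the final list of the woman `w`: her intended partner and, among the first
`k` men, those who never proposed to her. -/
def front (σ : ProposalState (Fin n)) (k : ℕ) (w : Fin n) : List (Fin n) :=
  w :: ((List.finRange n).take k).filter fun i => i ≠ w ∧ i ∉ σ.log w ∧ i ∉ σ.bl w

theorem front_succ (σ : ProposalState (Fin n)) {k : ℕ} (hk : k < n) (w : Fin n) :
    σ.front (k + 1) w = σ.front k w ++
      if (⟨k, hk⟩ : Fin n) ≠ w ∧ (⟨k, hk⟩ : Fin n) ∉ σ.log w ∧ (⟨k, hk⟩ : Fin n) ∉ σ.bl w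
        then [⟨k, hk⟩] else [] := by
  have h1 : (List.finRange n)[k]? = some ⟨k, hk⟩ := by simp [hk]
  simp only [front, List.take_add_one, h1, Option.toList_some, List.filter_append,
    List.filter_singleton, List.cons_append, Bool.cond_decide]

theorem length_front_le (σ : ProposalState (Fin n)) (k : ℕ) (w : Fin n) :
    (σ.front k w).length ≤ (σ.front n w).length := by
  simp only [front, List.length_cons, Nat.add_le_add_iff_right]
  rw [List.take_of_length_le (by simp : (List.finRange n).length ≤ n)]
  exact ((List.take_sublist _ _).filter _).length_le

theorem mem_front (w i : Fin n) :
    i ∈ σ.front n w ↔ i = w ∨ (i ≠ w ∧ i ∉ σ.log w ∧ i ∉ σ.bl w) := by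
  simp [front, List.take_of_length_le]

theorem Inv.nodup_front_append (h : σ.Inv P) (w : Fin n) : (σ.front n w ++ σ.log w).Nodup := by
  refine List.Nodup.append ?_ (h.log_nodup w) ?_
  · rw [front, List.nodup_cons]
    exact ⟨by simp, (((List.nodup_finRange n).sublist (List.take_sublist _ _)).filter _)⟩
  · intro i hi hi'
    rw [mem_front] at hi
    rcases hi with rfl | hi
    · exact h.self_log i hi'
    · exact hi.2.1 hi'

theorem Inv.mem_front_append (h : σ.Inv P) (w i : Fin n) :
    i ∈ σ.front n w ++ σ.log w ↔ i ∉ σ.bl w := by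
  rw [List.mem_append, mem_front]
  have h1 := h.self_bl w
  have h2 := h.log_bl w i
  by_cases hi : i = w
  · subst hi
    simp [h1]
  · tauto

theorem Inv.length_front (h : σ.Inv P) (w : Fin n) :
    (σ.front n w).length + (σ.log w).length + (σ.bl w).card = n := by
  rw [← List.length_append, ← List.toFinset_card_of_nodup (h.nodup_front_append w)]
  have : (σ.front n w ++ σ.log w).toFinset = (σ.bl w)ᶜ := by
    ext i
    rw [List.mem_toFinset, h.mem_front_append, Finset.mem_compl]
  rw [this, Finset.card_compl_add_card, Fintype.card_fin]

/-- The women's lists that result from a state in which everybody is matched as intended. -/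
def finalProfile (h : σ.Inv P) : Profile (Fin n) (Fin n) :=
  fun w => ⟨σ.front n w ++ σ.log w, h.nodup_front_append w⟩

theorem Inv.forces_finalProfile (h : σ.Inv P) (hP : ∀ i, i ∈ (P i).toList)
    (hold : ∀ w, σ.hold w = some w) :
    ForcesInconspicuously P (Equiv.refl (Fin n)) (finalProfile h) :=
  h.forcesInconspicuously hP hold (fun _ => ⟨_, rfl⟩) h.mem_front_append

end ProposalState

namespace RAMProgram

open RAMState

variable {n : ℕ} {P : Profile (Fin n) (Fin n)} {μ : Fin n ≃ Fin n} {σ : ProposalState (Fin n)}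
  {s : RAMState}

/-- Initialize the arrays. -/
def initBody : RAMProgram :=
  seq (store 9 4 1 0) <| seq (store 4 4 1 0) <| seq (store 6 4 1 4) <| seq (store 5 4 1 0) <|
  succ 4 4

/-- Initialize the arrays and the registers. -/
def initCode : RAMProgram := seq (seq (const 2 1) (const 4 0)) (whileLT 4 0 initBody)

theorem exec_initCode (PM : Profile (Fin n) (Fin n)) (μ : Fin n ≃ Fin n) :
    ∃ t s, initCode.Exec (inputState n PM μ) t s ∧
      Represents (fun i => PM (μ i)) μ ProposalState.init s ∧ s.reg 3 = 0 ∧ t ≤ 6 * n + 3 := by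
  obtain ⟨t, ht, he⟩ := exec_eval (p := seq (const 2 1) (const 4 0)) (by simp [LoopFree])
    (inputState n PM μ)
  simp only [cost] at ht
  obtain ⟨t', s, k, he', ⟨h1, h2, h3, h4, h5, h6, h7, h8⟩, h9, h10⟩ := exec_while (x := 4) (y := 0)
    (p := initBody)
    (fun k s => k ≤ n ∧ s.reg 0 = n ∧ s.reg 1 = 0 ∧ s.reg 2 = 1 ∧ s.reg 3 = 0 ∧ s.reg 4 = k ∧
      (∀ a i j, a = 0 ∨ a = 2 ∨ a = 7 ∨ a = 8 →
        s.arr a i j = (inputState n PM μ).arr a i j) ∧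
      ∀ w < k, s.arr 9 w 0 = n ∧ s.arr 4 w 0 = n ∧ s.arr 6 w 0 = w ∧ s.arr 5 w 0 = n)
    (fun k => 6 * (n - k)) (by
      rintro k s ⟨h1, h2, h3, h4, h5, h6, h7, h8⟩ hlt
      rw [h6, h2] at hlt
      obtain ⟨t, ht, he⟩ := exec_eval (p := initBody) (by simp [LoopFree, initBody]) s
      simp only [cost, initBody] at ht
      refine ⟨t, _, k + 1, he, ⟨hlt, ?_⟩, by omega⟩
      simp only [initBody, eval, setReg_reg, setArr_reg, setReg_arr, h2, h3, h4, h5, h6,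
        Nat.reduceEqDiff, reduceIte, OfNat.one_ne_ofNat, OfNat.zero_ne_ofNat, true_and]
      refine ⟨fun a i j ha => ?_, fun w hw => ?_⟩
      · rw [← h7 a i j ha]
        simp only [setArr_arr]
        rcases ha with rfl | rfl | rfl | rfl <;> simp
      · rcases Nat.lt_succ_iff_lt_or_eq.1 hw with hw | rfl
        · simpa [setArr_arr, hw.ne] using h8 w hw
        · simp [setArr_arr])
    0 ((seq (const 2 1) (const 4 0)).eval (inputState n PM μ)) (by
      simp [eval, inputState])
  obtain rfl : k = n := by
    rw [h6, h2] at h9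
    omega
  refine ⟨t + t', s, he.seq he', ?_, h5, by omega⟩
  exact {
    size := h2
    zero := h3
    one := h4
    list := fun i j w hw => by
      rw [h7 0 _ _ (by simp)]
      simp [inputState, hw]
    partner := fun i => by
      rw [h7 2 _ _ (by simp)]
      simp [inputState]
    hold := fun w => by simpa [ProposalState.init] using (h8 w w.2).2.2.2
    lab := fun w => by simpa [ProposalState.init] using (h8 w w.2).2.2.1
    ptr := fun i => by
      rw [h7 7 _ _ (by simp)]
      simp [inputState, ProposalState.init]
    mark := fun w i => by
      rw [h7 8 _ _ (by simp)]
      simp [inputState, ProposalState.init]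
    slots := fun w => by simpa [ProposalState.init] using (h8 w w.2).1
    length := fun w => by simpa [ProposalState.init] using (h8 w w.2).2.1
    out := fun w k hk => by simp [ProposalState.init] at hk }

/-- Let the men enter one by one. -/
def firstBody : RAMProgram :=
  seq (seq (copy 5 4) (const 6 0)) (seq (whileLT 6 2 chainBody) (succ 4 4))

/-- The first stage of the algorithm. -/
def firstCode : RAMProgram := seq (const 4 0) (whileLT 4 0 firstBody)

/-- The invariant of the first stage: the men from number `k` on have not entered, and nobody has
been blacklisted. -/
structure FirstState (P : Profile (Fin n) (Fin n)) (μ : Fin n ≃ Fin n)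
    (σ : ProposalState (Fin n)) (k : ℕ) (s : RAMState) : Prop where
  le : k ≤ n
  inv : σ.Inv P
  free : ∀ j, σ.Free j ↔ k ≤ j
  bl : ∀ w, σ.bl w = ∅
  rep : Represents P μ σ s
  stage : s.reg 3 = 0
  outer : s.reg 4 = k

theorem exec_firstBody (hP : ∀ i, i ∈ (P i).toList) {k : ℕ} (h : FirstState P μ σ k s)
    (hk : k < n) :
    ∃ t s' σ', firstBody.Exec s t s' ∧ FirstState P μ σ' (k + 1) s' ∧
      t + potential σ' ≤ potential σ + (9 * n + 54) := by
  obtain ⟨t, ht, he⟩ := exec_eval (p := seq (copy 5 4) (const 6 0)) (by simp [LoopFree]) s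
  simp only [cost] at ht
  obtain ⟨t', s', σ', a', c', he', hc', ⟨hC, hR, hG⟩, ht'⟩ :=
    exec_chain (st := 0) (i := k) (F := {j | k < j}) (a := ⟨k, hk⟩) (c := 0) (σ := σ) (μ := μ)
      (s := (seq (copy 5 4) (const 6 0)).eval s) hP (by
      refine ⟨⟨h.inv, fun j => ?_, by simp, fun _ => h.bl, by simp, by simp⟩,
        (h.rep.setReg (by norm_num) _).setReg (by norm_num) _, ?_⟩
      · rw [h.free, Set.mem_ofPred_eq, Fin.ext_iff]
        simp only [true_and]
        omega
      · constructor <;> simp [eval, h.stage, h.outer])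
  refine ⟨t + (t' + 1), _, σ', he.seq (he'.seq (.succ s' 4 4)), ⟨hk, hC.inv, fun j => ?_,
    hC.first rfl, hR.setReg (by norm_num) _, by simp [hG.stage], by simp [hG.outer]⟩, by omega⟩
  rw [hC.free]
  simp [hc']

theorem potential_init : potential (ProposalState.init : ProposalState (Fin n)) ≤
    59 * (n * n) + 50 * n := by
  have h1 : (ProposalState.init : ProposalState (Fin n)).pending = n * n := by
    simp [ProposalState.pending, ProposalState.init]
  have h2 : (ProposalState.init : ProposalState (Fin n)).numClasses = n := by
    simp [ProposalState.numClasses, ProposalState.init]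
  rw [potential, h1, h2]
  ring_nf
  omega

theorem exec_firstCode (hP : ∀ i, i ∈ (P i).toList)
    (h : Represents P μ ProposalState.init s) (h3 : s.reg 3 = 0) :
    ∃ t s' σ, firstCode.Exec s t s' ∧ FirstState P μ σ n s' ∧
      t + potential σ ≤ 70 * (n * n) + 110 * n + 2 := by
  obtain ⟨t, s', ⟨σ, k⟩, he, h1, h2, h4⟩ := exec_while (x := 4) (y := 0) (p := firstBody)
    (fun (q : ProposalState (Fin n) × ℕ) s => FirstState P μ q.1 q.2 s)
    (fun q => potential q.1 + (9 * n + 55) * (n - q.2)) (by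
      rintro ⟨σ, k⟩ s h hlt
      change FirstState P μ σ k s at h
      have hk : k < n := by
        have h1 : s.reg 4 = k := h.outer
        rwa [h1, h.rep.size] at hlt
      obtain ⟨t, s', σ', he, h', ht⟩ := exec_firstBody hP h hk
      refine ⟨t, s', (σ', k + 1), he, h', ?_⟩
      have h1 : n - k = n - (k + 1) + 1 := by omega
      change t + 1 + (potential σ' + (9 * n + 55) * (n - (k + 1))) ≤
        potential σ + (9 * n + 55) * (n - k)
      rw [h1, mul_add, mul_one]
      omega)
    (ProposalState.init, 0) (s.setReg 4 0)
    ⟨Nat.zero_le _, ProposalState.inv_init P, by simp [ProposalState.Free, ProposalState.init],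
      fun _ => rfl, h.setReg (by norm_num) _, by simp [h3], by simp⟩
  simp only at h1 h4
  obtain rfl : k = n := by
    have := h1.le
    rw [h1.outer, h1.rep.size] at h2
    omega
  refine ⟨1 + t, s', σ, (Exec.const s 4 0).seq he, h1, ?_⟩
  have := potential_init (n := k)
  have e : (9 * k + 55) * (k - 0) = 9 * (k * k) + 55 * k := by rw [Nat.sub_zero]; ring
  rw [e] at h4
  omega

/-- If the woman in register 4 is a root not matched as intended, she dismisses and blacklists the
man whom she holds, which starts a chain of proposals. -/
def dismissCode : RAMProgram :=
  seq (load 12 6 4 1) <| seq (load 10 5 4 1) <| seq (copy 5 4) <| seq (const 6 1) <|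
  ifEq 12 4
    (ifEq 10 4 skip
      (seq (store 5 4 1 0) (seq (banCode 4 10) (seq (copy 5 10) (const 6 0)))))
    skip

/-- Deal with one class. -/
def secondBody : RAMProgram := seq dismissCode (seq (whileLT 6 2 chainBody) (succ 4 4))

/-- The second stage of the algorithm. -/
def secondCode : RAMProgram := seq (seq (const 3 1) (const 4 0)) (whileLT 4 0 secondBody)

/-- The invariant of the second stage: everybody is matched, and the roots below `k` are matched
as intended. -/
structure SecondState (P : Profile (Fin n) (Fin n)) (μ : Fin n ≃ Fin n)
    (σ : ProposalState (Fin n)) (k : ℕ) (s : RAMState) : Prop where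
  le : k ≤ n
  inv : σ.Inv P
  free : ∀ j, ¬ σ.Free j
  done : ∀ j : Fin n, (j : ℕ) < k → σ.lab j = j → σ.hold j = some j
  rep : Represents P μ σ s
  stage : s.reg 3 = 1
  outer : s.reg 4 = k

theorem exec_dismissCode {k : ℕ} (h : SecondState P μ σ k s) (hk : k < n) :
    ∃ t s' σ' a c, dismissCode.Exec s t s' ∧ ChainState P μ 1 k ∅ σ' a c s' ∧
      t + potential σ' ≤ potential σ + 25 := by
  obtain ⟨t, ht, he⟩ := exec_eval (p := dismissCode)
    (by simp [LoopFree, dismissCode, ifEq, banCode]) s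
  replace ht : t ≤ 25 := ht.trans (by decide)
  set r : Fin n := ⟨k, hk⟩ with hr
  have hrk : (r : ℕ) = k := rfl
  obtain ⟨b, hb⟩ := Option.ne_none_iff_exists'.1 (ProposalState.hold_ne_none h.free r)
  let s1 : RAMState :=
    (((s.setReg 12 (σ.lab r)).setReg 10 b).setReg 5 k).setReg 6 1
  have hR1 : Represents P μ σ s1 := (((h.rep.setReg (by norm_num) _).setReg (by norm_num)
    _).setReg (by norm_num) _).setReg (by norm_num) _
  have heq : dismissCode.eval s = (ifEq 12 4
    (ifEq 10 4 skip
      (seq (store 5 4 1 0) (seq (banCode 4 10) (seq (copy 5 10) (const 6 0)))))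
    skip).eval s1 := by
    have h1 := h.rep.lab r
    have h2 := h.rep.hold r
    simp only [hb, Option.elim_some, hrk] at h1 h2
    simp only [dismissCode, eval, setReg_reg, setReg_arr, h.outer, h.rep.zero, h1, h2,
      Nat.reduceEqDiff, reduceIte, OfNat.one_ne_ofNat, s1]
  have s4 : s1.reg 4 = k := by simp [s1, h.outer]
  have s5 : s1.reg 5 = k := by simp [s1]
  have s3 : s1.reg 3 = 1 := by simp [s1, h.stage]
  have s6 : s1.reg 6 = 1 := by simp [s1]
  have s10 : s1.reg 10 = b := by simp [s1]
  have s12 : s1.reg 12 = σ.lab r := by simp [s1]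
  have skip_case : dismissCode.eval s = s1 → (σ.lab r = r → σ.hold r = some r) →
      ∃ t s' σ' a c, dismissCode.Exec s t s' ∧ ChainState P μ 1 k ∅ σ' a c s' ∧
      t + potential σ' ≤ potential σ + 25 := by
    intro heq' hdone
    rw [heq'] at he
    refine ⟨t, s1, σ, r, 1, he, ⟨⟨h.inv, by simpa using h.free, by simp, by simp,
      fun _ w hw => absurd hw (ProposalState.hold_ne_none h.free w), ?_⟩, hR1, s3, s4, s5, s6⟩,
      by omega⟩
    rintro - j (hj | ⟨hj, -⟩) hl
    · exact h.done j hj hl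
    · obtain rfl : j = r := Fin.ext hj
      exact hdone hl
  by_cases hl : σ.lab r = r
  · by_cases hbr : b = r
    · refine skip_case ?_ fun _ => by rw [hb, hbr]
      rw [heq, eval_ifEq, s12, s4, hl, hrk, if_pos rfl, eval_ifEq, s10, s4, hbr, if_pos rfl, eval]
    · have hbr' : (b : ℕ) ≠ k := fun hc => hbr (Fin.ext hc)
      have hinv := h.inv.dismiss hl hb hbr
      have hfree : ∀ j, (σ.dismiss r).Free j ↔ j = b := by
        intro j
        constructor
        · intro hj
          obtain ⟨u, hu⟩ : ∃ u, σ.hold u = some j := by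
            simpa [ProposalState.Free] using h.free j
          by_cases hur : u = r
          · rw [hur, hb] at hu
            exact (Option.some.inj hu).symm
          · exact absurd (by simpa [ProposalState.dismiss, hur] using hu) (hj u)
        · rintro rfl u hu
          by_cases hur : u = r
          · simp [ProposalState.dismiss, hur] at hu
          · exact hur (h.inv.inj u r j (by simpa [ProposalState.dismiss, hur] using hu) hb)
      have hn := h.inv.next r b hb
      obtain ⟨hbl, hbb⟩ := h.inv.notMem_of_next hn
      have hlog : σ.log r = [] := h.inv.log_root r hl (by rw [hb]; simpa using hbr)
      have hR2 := hR1.setHold r none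
      obtain ⟨hR3, hz3⟩ := represents_banCode (x := 4) (y := 10) (i := b) hR2 (by norm_num)
        (by norm_num) (by simp [s4, hrk]) (by simp [s10]) hlog hbb
        (hR1.slots_pos h.inv hbl hbb)
      set s2 := (banCode 4 10).eval (s1.setArr 5 r 0 ((none : Option (Fin n)).elim n Fin.val))
        with hs2
      have heq' : dismissCode.eval s = (s2.setReg 5 (s2.reg 10)).setReg 6 0 := by
        rw [heq, eval_ifEq, s12, s4, hl, hrk, if_pos rfl, eval_ifEq, s10, s4, if_neg hbr']
        simp only [eval, s4, hR1.zero, hR1.size, hs2, hrk, Option.elim_none]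
      have hinv' : ((σ.dismiss r).ban r b).Inv P :=
        hinv.ban ((hfree b).2 rfl) hn hbr (by simp [ProposalState.dismiss])
          ((h.inv.lab_hold r b hb).trans hl)
      rw [heq'] at he
      refine ⟨t, _, (σ.dismiss r).ban r b, b, 0, he, ⟨⟨hinv', fun j => (hfree j).trans (by simp),
        by simp, by simp, fun _ w hw => ⟨rfl, ?_⟩, ?_⟩,
        (hR3.setReg (by norm_num) _).setReg (by norm_num) _, ?_⟩, ?_⟩
      · by_contra hwk
        have hwr : w ≠ r := fun hc => hwk (by rw [hc])
        refine ProposalState.hold_ne_none h.free w ?_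
        simpa [ProposalState.ban, ProposalState.dismiss, hwr] using hw
      · rintro - j (hj | ⟨-, hj⟩) hlj
        · have hjr : j ≠ r := by
            rintro rfl
            exact lt_irrefl _ hj
          simpa [ProposalState.ban, ProposalState.dismiss, hjr] using h.done j hj hlj
        · exact absurd rfl hj
      · constructor <;> simp [hz3, s3, s4, s10]
      · have h1 := ProposalState.pending_ban (σ := σ.dismiss r) (w := r) (a := b) (n := n)
          (lt_of_lt_of_le (List.getElem?_eq_some_iff.1 hn).1
            (by simpa using (P b).nodup.length_le_card))
        have h2 : ((σ.dismiss r).ban r b).numClasses = σ.numClasses := rfl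
        have h3 : (σ.dismiss r).pending = σ.pending := rfl
        simp only [potential, h2]
        omega
  · have hl' : (σ.lab r : ℕ) ≠ k := fun hc => hl (Fin.ext hc)
    refine skip_case ?_ fun hc => absurd hc hl
    rw [heq, eval_ifEq, s12, s4, if_neg hl', eval]

theorem exec_secondBody (hP : ∀ i, i ∈ (P i).toList) {k : ℕ} (h : SecondState P μ σ k s)
    (hk : k < n) :
    ∃ t s' σ', secondBody.Exec s t s' ∧ SecondState P μ σ' (k + 1) s' ∧
      t + potential σ' ≤ potential σ + (9 * n + 77) := by
  obtain ⟨t, s1, σ1, a, c, he, hC1, ht⟩ := exec_dismissCode h hk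
  obtain ⟨t', s', σ', a', c', he', hc', ⟨hC, hR, hG⟩, ht'⟩ := exec_chain hP hC1
  refine ⟨t + (t' + 1), _, σ', he.seq (he'.seq (.succ s' 4 4)), ⟨hk, hC.inv, fun j => ?_,
    fun j hj hl => ?_, hR.setReg (by norm_num) _, by simp [hG.stage], by simp [hG.outer]⟩,
    by omega⟩
  · rw [hC.free]
    simp [hc']
  · refine hC.done one_ne_zero j ?_ hl
    rcases Nat.lt_succ_iff_lt_or_eq.1 hj with hj | hj
    · exact Or.inl hj
    · exact Or.inr ⟨hj, hc'⟩

theorem exec_secondCode (hP : ∀ i, i ∈ (P i).toList) (h : FirstState P μ σ n s) :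
    ∃ t s' σ', secondCode.Exec s t s' ∧ σ'.Inv P ∧ (∀ w, σ'.hold w = some w) ∧
      Represents P μ σ' s' ∧ t + potential σ' ≤ potential σ + 9 * (n * n) + 78 * n + 3 := by
  obtain ⟨t, s', ⟨σ', k⟩, he, h1, h2, h4⟩ := exec_while (x := 4) (y := 0) (p := secondBody)
    (fun (q : ProposalState (Fin n) × ℕ) s => SecondState P μ q.1 q.2 s)
    (fun q => potential q.1 + (9 * n + 78) * (n - q.2)) (by
      rintro ⟨σ, k⟩ s h hlt
      change SecondState P μ σ k s at h
      have hk : k < n := by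
        have h1 : s.reg 4 = k := h.outer
        rwa [h1, h.rep.size] at hlt
      obtain ⟨t, s', σ', he, h', ht⟩ := exec_secondBody hP h hk
      refine ⟨t, s', (σ', k + 1), he, h', ?_⟩
      have h1 : n - k = n - (k + 1) + 1 := by omega
      change t + 1 + (potential σ' + (9 * n + 78) * (n - (k + 1))) ≤
        potential σ + (9 * n + 78) * (n - k)
      rw [h1, mul_add, mul_one]
      omega)
    (σ, 0) ((s.setReg 3 1).setReg 4 0)
    ⟨Nat.zero_le _, h.inv, fun j hj => by have := (h.free j).1 hj; omega, by simp,
      (h.rep.setReg (by norm_num) _).setReg (by norm_num) _, by simp, by simp⟩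
  simp only at h1 h4
  obtain rfl : k = n := by
    have := h1.le
    rw [h1.outer, h1.rep.size] at h2
    omega
  refine ⟨1 + 1 + t, s', σ', ((Exec.const s 3 1).seq (Exec.const _ 4 0)).seq he, h1.inv,
    fun w => ?_, h1.rep, ?_⟩
  · exact h1.inv.hold_self_of_root
      (h1.done _ (σ'.lab w).2 (h1.inv.lab_idem w)) rfl
  have e : (9 * k + 78) * (k - 0) = 9 * (k * k) + 78 * k := by rw [Nat.sub_zero]; ring
  rw [e] at h4
  omega

end RAMProgram

/-! ### Output -/

/-- Row `w` of the output array starts with the men named by `l`. -/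
def RowStarts {n : ℕ} (μ : Fin n ≃ Fin n) (s : RAMState) (w : ℕ) (l : List (Fin n)) : Prop :=
  ∀ j i, l[j]? = some i → s.arr 3 w j = μ i

namespace RAMProgram

open RAMState

variable {n : ℕ} {P : Profile (Fin n) (Fin n)} {μ : Fin n ≃ Fin n} {σ : ProposalState (Fin n)}
  {s : RAMState}

/-- Cells to the left of the rejected men may be overwritten. -/
theorem _root_.Represents.setOut (h : Represents P μ σ s) {w : Fin n} {j : ℕ}
    (hj : j < s.arr 9 w 0) (v : ℕ) : Represents P μ σ (s.setArr 3 w j v) where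
  __ := h
  out := by
    intro u k hk
    have h1 := h.out u k hk
    by_cases hu : u = w
    · subst hu
      have h2 : s.arr 9 u 0 + k ≠ j := by omega
      simpa [setArr_arr, h2] using h1
    · simpa [setArr_arr, hu, Fin.val_inj] using h1

theorem _root_.RowStarts.append {l : List (Fin n)} {w : ℕ} (h : RowStarts μ s w l) (i : Fin n) :
    RowStarts μ (s.setArr 3 w l.length (μ i)) w (l ++ [i]) := by
  intro j i' hj
  rcases lt_trichotomy j l.length with hl | rfl | hl
  · rw [List.getElem?_append_left hl] at hj
    simpa [setArr_arr, hl.ne] using h j i' hj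
  · obtain rfl : i = i' := by simpa using hj
    simp [setArr_arr]
  · have := (List.getElem?_eq_some_iff.1 hj).1
    simp at this
    omega

theorem _root_.RowStarts.of_ne {l : List (Fin n)} {w u : ℕ} (h : RowStarts μ s u l) (hu : u ≠ w)
    (j v : ℕ) : RowStarts μ (s.setArr 3 w j v) u l := by
  intro j' i hj
  simpa [setArr_arr, hu] using h j' i hj

/-- Write the man in register 14 to the row of the woman in register 4, at the position in register
9, if he never proposed to her. -/
def fillBody : RAMProgram :=
  seq (load 10 8 4 14) <|
  seq (ifEq 14 4 skip
    (ifLT 10 2 (seq (load 15 2 14 1) (seq (store 3 4 9 15) (succ 9 9))) skip)) <|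
  succ 14 14

/-- Write the list of the woman in register 4 up to the men she rejected, who are there already. -/
def outBody : RAMProgram :=
  seq (seq (load 15 2 4 1) <| seq (store 3 4 1 15) <| seq (const 9 1) <| const 14 0) <|
  seq (whileLT 14 0 fillBody) (succ 4 4)

/-- Complete the women's lists. -/
def outCode : RAMProgram := seq (const 4 0) (whileLT 4 0 outBody)

/-- The invariant of the output phase: the rows below `w` are complete. -/
structure OutState (P : Profile (Fin n) (Fin n)) (μ : Fin n ≃ Fin n)
    (σ : ProposalState (Fin n)) (w : ℕ) (s : RAMState) : Prop where
  le : w ≤ n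
  rep : Represents P μ σ s
  outer : s.reg 4 = w
  rows : ∀ u : Fin n, (u : ℕ) < w → RowStarts μ s u (σ.front n u)

theorem exec_fillBody (hσ : σ.Inv P) {w : Fin n} {k : ℕ} (hk : k < n)
    (h : OutState P μ σ w s) (h14 : s.reg 14 = k) (h9 : s.reg 9 = (σ.front k w).length)
    (hrow : RowStarts μ s w (σ.front k w)) :
    ∃ t ≤ 8, ∃ s', fillBody.Exec s t s' ∧ OutState P μ σ w s' ∧ s'.reg 14 = k + 1 ∧
      s'.reg 9 = (σ.front (k + 1) w).length ∧ RowStarts μ s' w (σ.front (k + 1) w) := by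
  obtain ⟨t, ht, he⟩ := exec_eval (p := fillBody) (by simp [LoopFree, fillBody, ifEq]) s
  refine ⟨t, ht.trans (by decide), _, he, ?_⟩
  have hmark := h.rep.mark w ⟨k, hk⟩
  simp only at hmark
  have hfront := σ.front_succ hk w
  by_cases hc : (⟨k, hk⟩ : Fin n) ≠ w ∧ (⟨k, hk⟩ : Fin n) ∉ σ.log w ∧ (⟨k, hk⟩ : Fin n) ∉ σ.bl w
  · have hkw : k ≠ w := fun hkw => hc.1 (Fin.ext hkw)
    rw [if_neg (by tauto)] at hmark
    rw [if_pos hc] at hfront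
    have hpart := h.rep.partner ⟨k, hk⟩
    have heq : fillBody.eval s = ((((s.setArr 3 w (σ.front k w).length
        (μ ⟨k, hk⟩)).setReg 10 0).setReg 15 (μ ⟨k, hk⟩)).setReg 9
        ((σ.front k w).length + 1)).setReg 14 (k + 1) := by
      simp only [fillBody, eval, eval_ifEq, setReg_reg, setArr_reg, setReg_arr, setReg_setArr,
        h.outer, h14, h9, hmark, hpart, h.rep.zero, h.rep.one, hkw, Nat.reduceEqDiff, reduceIte,
        OfNat.one_ne_ofNat, zero_lt_one]
    have hpos : (σ.front k w).length < s.arr 9 w 0 := by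
      have h1 := σ.length_front_le (k + 1) w
      have h2 := hσ.length_front w
      have h3 := h.rep.slots w
      rw [hfront, List.length_append, List.length_singleton] at h1
      omega
    rw [heq]
    refine ⟨⟨h.le, ((((h.rep.setOut hpos _).setReg (by norm_num) _).setReg (by norm_num)
      _).setReg (by norm_num) _).setReg (by norm_num) _, by simp [h.outer],
      fun u hu => (h.rows u hu).of_ne hu.ne _ _⟩, by simp, by simp [hfront], ?_⟩
    rw [hfront]
    exact hrow.append _
  · rw [if_neg hc, List.append_nil] at hfront
    have heq : fillBody.eval s = (s.setReg 10 (s.arr 8 w k)).setReg 14 (k + 1) := by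
      by_cases hkw : k = w
      · simp only [fillBody, eval, eval_ifEq, setReg_reg, h.outer, h14, hkw, Nat.reduceEqDiff,
          reduceIte]
      · have hkw' : (⟨k, hk⟩ : Fin n) ≠ w := fun hc => hkw (Fin.ext_iff.1 hc)
        rw [if_pos (by tauto)] at hmark
        simp only [fillBody, eval, eval_ifEq, setReg_reg, h.outer, h14, hkw, Nat.reduceEqDiff,
          reduceIte, hmark, h.rep.one, lt_irrefl]
    rw [heq, hfront]
    exact ⟨⟨h.le, (h.rep.setReg (by norm_num) _).setReg (by norm_num) _, by simp [h.outer],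
      h.rows⟩, by simp, by simp [h9], hrow⟩

theorem exec_outBody (hσ : σ.Inv P) {w : Fin n} (h : OutState P μ σ w s) :
    ∃ t s', outBody.Exec s t s' ∧ OutState P μ σ (w + 1) s' ∧ t ≤ 9 * n + 6 := by
  obtain ⟨t, ht, he⟩ := exec_eval
    (p := seq (load 15 2 4 1) <| seq (store 3 4 1 15) <| seq (const 9 1) <| const 14 0)
    (by simp [LoopFree]) s
  simp only [cost] at ht
  have heq : (seq (load 15 2 4 1) <| seq (store 3 4 1 15) <| seq (const 9 1) <| const 14 0).eval s
      = (((s.setArr 3 w 0 (μ w)).setReg 15 (μ w)).setReg 9 1).setReg 14 0 := by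
    simp only [eval, setReg_reg, setReg_setArr, h.outer, h.rep.zero, h.rep.partner,
      Nat.reduceEqDiff, reduceIte, OfNat.one_ne_ofNat]
  rw [heq] at he
  have hfront : σ.front 0 w = [w] := by simp [ProposalState.front]
  have hpos : 0 < s.arr 9 w 0 := by
    have h1 := σ.length_front_le 0 w
    have h2 := hσ.length_front w
    have h3 := h.rep.slots w
    rw [hfront, List.length_singleton] at h1
    omega
  obtain ⟨t', s', k, he', ⟨h1, h2, h3, h4, h5⟩, h6, h7⟩ := exec_while (x := 14) (y := 0)
    (p := fillBody)
    (fun k s => k ≤ n ∧ OutState P μ σ w s ∧ s.reg 14 = k ∧ s.reg 9 = (σ.front k w).length ∧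
      RowStarts μ s w (σ.front k w))
    (fun k => 9 * (n - k)) (by
      rintro k s ⟨h1, h2, h3, h4, h5⟩ hlt
      rw [h3, h2.rep.size] at hlt
      obtain ⟨t, ht, s', he, h'⟩ := exec_fillBody hσ hlt h2 h3 h4 h5
      exact ⟨t, s', k + 1, he, ⟨hlt, h'⟩, by omega⟩)
    0 ((((s.setArr 3 w 0 (μ w)).setReg 15 (μ w)).setReg 9 1).setReg 14 0)
    ⟨Nat.zero_le _, ⟨h.le, (((h.rep.setOut hpos _).setReg (by norm_num) _).setReg (by norm_num)
      _).setReg (by norm_num) _, by simp [h.outer], fun u hu => (h.rows u hu).of_ne hu.ne _ _⟩,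
      by simp, by simp [hfront], by
        rw [hfront]
        exact RowStarts.append (l := []) (fun j i hj => by simp at hj) w⟩
  obtain rfl : k = n := by
    rw [h3, h2.rep.size] at h6
    omega
  refine ⟨t + (t' + 1), _, he.seq (he'.seq (.succ s' 4 4)), ⟨w.2, h2.rep.setReg (by norm_num) _,
    by simp [h2.outer], fun u hu => ?_⟩, by omega⟩
  rcases Nat.lt_succ_iff_lt_or_eq.1 hu with hu | hu
  · exact h2.rows u hu
  · obtain rfl : u = w := Fin.ext hu
    exact h5

theorem exec_outCode (hσ : σ.Inv P) (h : Represents P μ σ s) :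
    ∃ t s', outCode.Exec s t s' ∧ OutState P μ σ n s' ∧ t ≤ 9 * (n * n) + 7 * n + 2 := by
  obtain ⟨t, s', k, he, h1, h2, h4⟩ := exec_while (x := 4) (y := 0) (p := outBody)
    (fun k s => OutState P μ σ k s) (fun k => (9 * n + 7) * (n - k)) (by
      rintro k s h hlt
      have hk : k < n := by rwa [h.outer, h.rep.size] at hlt
      obtain ⟨t, s', he, h', ht⟩ := exec_outBody (w := ⟨k, hk⟩) hσ h
      refine ⟨t, s', k + 1, he, h', ?_⟩
      have h1 : n - k = n - (k + 1) + 1 := by omega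
      rw [h1, mul_add, mul_one]
      omega)
    0 (s.setReg 4 0) ⟨Nat.zero_le _, h.setReg (by norm_num) _, by simp, by simp⟩
  obtain rfl : k = n := by
    have := h1.le
    rw [h1.outer, h1.rep.size] at h2
    omega
  refine ⟨1 + t, s', (Exec.const s 4 0).seq he, h1, ?_⟩
  have e : (9 * k + 7) * (k - 0) = 9 * (k * k) + 7 * k := by rw [Nat.sub_zero]; ring
  rw [e] at h4
  omega

end RAMProgram

/-! ### Renaming the participants -/

namespace PrefList

variable {α β : Type*}

/-- The list of the images under a bijection. -/
def map (f : α ≃ β) (L : PrefList α) : PrefList β := ⟨L.toList.map f, L.nodup.map f.injective⟩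

theorem prefers_map (f : α ≃ β) (L : PrefList α) (a b : α) :
    (L.map f).Prefers (f a) (f b) ↔ L.Prefers a b := by
  constructor
  · intro h
    have h1 := h.map f.symm
    simpa [map, Prefers, Function.comp_def] using h1
  · intro h
    simpa [map, Prefers] using h.map f

theorem mem_blacklist_map (f : α ≃ β) (L : PrefList α) (a : α) :
    f a ∈ (L.map f).blacklist ↔ a ∈ L.blacklist := by
  exact not_congr (List.mem_map_of_injective f.injective)

theorem blacklist_map (f : α ≃ β) (L : PrefList α) : (L.map f).blacklist = f '' L.blacklist := by
  ext b
  obtain ⟨a, rfl⟩ := f.surjective b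
  rw [mem_blacklist_map, f.injective.mem_set_image]

theorem map_refl (L : PrefList α) : L.map (Equiv.refl α) = L := by
  cases L
  simp [map]

end PrefList

/-- The claim may be checked after the women are renamed by `e`, and each man is given the name of
his intended partner. -/
theorem ForcesInconspicuously.rename {W M V : Type*} [Fintype W] [Fintype V] (e : V ≃ W)
    (μ : W ≃ M) {PM : Profile M W} {PV : Profile V V}
    (h : ForcesInconspicuously (fun v => (PM (μ (e v))).map e.symm) (Equiv.refl V) PV) :
    ForcesInconspicuously PM μ (fun w => (PV (e.symm w)).map (e.trans μ)) := by
  set f : V ≃ M := e.trans μ with hf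
  set PW : Profile W M := fun w => (PV (e.symm w)).map f with hPW
  set P : Profile V V := fun v => (PM (μ (e v))).map e.symm with hP
  have eW : ∀ v, PW (e v) = (PV v).map f := fun v => by simp [hPW]
  have eM : ∀ v, PM (f v) = (P v).map e := fun v => by
    simp [hP, hf, PrefList.map, Function.comp_def]
  have hB : ∀ v, (PW (e v)).blacklist = f '' (PV v).blacklist := fun v => by
    rw [eW, PrefList.blacklist_map]
  have hnum : numNonemptyBlacklists PW = numNonemptyBlacklists PV := by
    have : {w | (PW w).blacklist.Nonempty} = e '' {v | (PV v).blacklist.Nonempty} := by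
      ext w
      obtain ⟨v, rfl⟩ := e.surjective w
      rw [e.injective.mem_set_image, Set.mem_ofPred_eq, Set.mem_ofPred_eq, hB, Set.image_nonempty]
    rw [numNonemptyBlacklists, this, Set.ncard_image_of_injective _ e.injective]
    rfl
  have hsize : combinedBlacklistSize PW = combinedBlacklistSize PV := by
    rw [combinedBlacklistSize, ← e.sum_comp]
    exact Finset.sum_congr rfl fun v _ => by rw [hB, Set.ncard_image_of_injective _ f.injective]
  have hcard : Fintype.card W = Fintype.card V := (Fintype.card_congr e).symm
  refine ⟨fun ν => ?_, fun w w' hne => ?_, ?_, ?_⟩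
  · set ν' : Matching V V := e.toPEquiv.trans (ν.trans f.symm.toPEquiv) with hν'
    have h1 : ∀ v, ν' v = (ν (e v)).map f.symm := fun v => by
      simp [hν', PEquiv.trans, Option.map_eq_bind, Function.comp_def, Equiv.toPEquiv]
    have hsome : ∀ v i, ν (e v) = some (f i) ↔ ν' v = some i := fun v i => by
      rw [h1, Option.map_eq_some_iff]
      constructor
      · intro h2
        exact ⟨f i, h2, by simp⟩
      · rintro ⟨m, h2, rfl⟩
        simpa using h2
    have hnone : ∀ v, ν (e v) = none ↔ ν' v = none := fun v => by rw [h1, Option.map_eq_none_iff]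
    have hsome' : ∀ v i, ν.symm (f i) = some (e v) ↔ ν'.symm i = some v := fun v i => by
      rw [PEquiv.eq_some_iff, PEquiv.eq_some_iff, hsome]
    have hnone' : ∀ i, ν.symm (f i) = none ↔ ν'.symm i = none := fun i => by
      rw [Option.eq_none_iff_forall_ne_some, Option.eq_none_iff_forall_ne_some,
        ← e.forall_congr_right]
      exact forall_congr' fun v => not_congr (hsome' v i)
    have hW : IsWRational PW ν ↔ IsWRational PV ν' := by
      unfold IsWRational
      rw [← e.forall_congr_right]
      refine forall_congr' fun v => ?_
      rw [← f.forall_congr_right]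
      refine forall_congr' fun i => ?_
      rw [hsome, eW, PrefList.mem_blacklist_map]
    have hM : IsMRational PM ν ↔ IsMRational P ν' := by
      unfold IsMRational
      rw [← f.forall_congr_right]
      refine forall_congr' fun i => ?_
      rw [← e.forall_congr_right]
      refine forall_congr' fun v => ?_
      rw [hsome', eM, PrefList.mem_blacklist_map]
    have hBl : ∀ v i, IsBlockingPair PW PM ν (e v) (f i) ↔ IsBlockingPair PV P ν' v i := by
      intro v i
      unfold IsBlockingPair
      rw [← f.exists_congr_right, ← e.exists_congr_right]
      simp only [hsome, hsome', hnone, hnone', eW, eM, PrefList.mem_blacklist_map,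
        PrefList.prefers_map]
    have hS : IsStable PW PM ν ↔ IsStable PV P ν' := by
      unfold IsStable
      rw [hW, hM, ← e.forall_congr_right]
      refine and_congr_right fun _ => and_congr_right fun _ => forall_congr' fun v => ?_
      rw [← f.forall_congr_right]
      exact forall_congr' fun i => not_congr (hBl v i)
    rw [hS, h.unique_stable]
    constructor
    · intro h2
      refine PEquiv.ext fun w => ?_
      obtain ⟨v, rfl⟩ := e.surjective w
      exact (hsome v v).2 (by rw [h2]; rfl)
    · rintro rfl
      exact PEquiv.ext fun v => (hsome v v).1 rfl
  · obtain ⟨v, rfl⟩ := e.surjective w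
    obtain ⟨v', rfl⟩ := e.surjective w'
    rw [hB, hB, Set.disjoint_image_iff f.injective]
    exact h.disjoint_blacklists v v' fun hc => hne (congrArg e hc)
  · rw [hnum, hcard]
    exact h.numNonempty_le
  · rw [hnum, hsize, hcard]
    exact h.combinedSize_le

/-! ### Correctness and running time -/

/-- The algorithm: after the first stage everybody is matched, after the second one as intended. -/
def algorithm : RAMProgram :=
  .seq RAMProgram.initCode (.seq RAMProgram.firstCode
    (.seq RAMProgram.secondCode RAMProgram.outCode))

/-- The algorithm is correct, and its running time is quadratic on all inputs. -/
theorem exec_algorithm (n : ℕ) (PM : Profile (Fin n) (Fin n)) (μ : Fin n ≃ Fin n)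
    (h : IsMRational PM μ.toPEquiv) :
    ∃ (t : ℕ) (s : RAMState) (PW : Profile (Fin n) (Fin n)),
      algorithm.Exec (inputState n PM μ) t s ∧ IsOutput s PW ∧ ForcesInconspicuously PM μ PW ∧
        t ≤ 150 * (n + 1) ^ 2 := by
  set P : Profile (Fin n) (Fin n) := fun i => PM (μ i) with hPdef
  have hP : ∀ i, i ∈ (P i).toList := fun i => by
    by_contra hc
    exact h (μ i) i (by simp [← Equiv.toPEquiv_symm]) hc
  obtain ⟨t₁, s₁, he₁, hR₁, h3, ht₁⟩ := RAMProgram.exec_initCode PM μ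
  obtain ⟨t₂, s₂, σ₂, he₂, hF, ht₂⟩ := RAMProgram.exec_firstCode hP hR₁ h3
  obtain ⟨t₃, s₃, σ, he₃, hσ, hold, hR₃, ht₃⟩ := RAMProgram.exec_secondCode hP hF
  obtain ⟨t₄, s, he₄, hO, ht₄⟩ := RAMProgram.exec_outCode hσ hR₃
  have hforce := hσ.forces_finalProfile hP hold
  set PV := ProposalState.finalProfile hσ with hPV
  have hforce' := ForcesInconspicuously.rename (Equiv.refl (Fin n)) μ (PM := PM) (PV := PV) (by
    simpa [PrefList.map_refl] using hforce)
  -- the final list of `w` has `s.arr 9 w 0` entries before the rejected men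
  refine ⟨t₁ + (t₂ + (t₃ + t₄)), s, _, he₁.seq (he₂.seq (he₃.seq he₄)), fun w => ?_, hforce', ?_⟩
  · have hlist : ((PV ((Equiv.refl (Fin n)).symm w)).map ((Equiv.refl (Fin n)).trans μ)).toList =
        (σ.front n w ++ σ.log w).map μ := rfl
    have hlen := hσ.length_front w
    have hslots := hO.rep.slots w
    refine ⟨?_, fun j hj => ?_⟩
    · rw [hlist, List.length_map, List.length_append]
      have := hO.rep.length w
      omega
    · simp only [hlist, List.getElem_map]
      have hj' : j < (σ.front n w).length + (σ.log w).length := by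
        rw [hlist, List.length_map, List.length_append] at hj
        exact hj
      by_cases hjf : j < (σ.front n w).length
      · rw [List.getElem_append_left hjf]
        exact hO.rows w w.2 j _ (List.getElem?_eq_getElem hjf)
      · rw [List.getElem_append_right (by omega)]
        have := hO.rep.out w (j - (σ.front n w).length) (by omega)
        rw [← this]
        congr 1
        omega
  · have e : (n + 1) ^ 2 = n * n + 2 * n + 1 := by ring
    rw [e]
    omega

theorem mainTheorem1 :
    (∀ (W : Type u) (M : Type v) [Fintype W] [Fintype M],
      Fintype.card W = Fintype.card M →
      ∀ (PM : Profile M W) (μ : W ≃ M), IsMRational PM μ.toPEquiv →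
        ∃ PW : Profile W M, ForcesInconspicuously PM μ PW) ∧
    (∃ (A : RAMProgram)
        (time : (n : ℕ) → Profile (Fin n) (Fin n) → (Fin n ≃ Fin n) → ℕ) (C : ℝ),
      (∀ (n : ℕ) (PM : Profile (Fin n) (Fin n)) (μ : Fin n ≃ Fin n),
        IsMRational PM μ.toPEquiv →
        ∃ (s : RAMState) (PW : Profile (Fin n) (Fin n)),
          A.Exec (inputState n PM μ) (time n PM μ) s ∧ IsOutput s PW ∧
            ForcesInconspicuously PM μ PW) ∧
      -- worst case
      (∀ (n : ℕ), 1 ≤ n → ∀ (PM : Profile (Fin n) (Fin n)) (μ : Fin n ≃ Fin n),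
        IsMRational PM μ.toPEquiv → (time n PM μ : ℝ) ≤ C * (n : ℝ) ^ 3) ∧
      -- best case
      (∀ (n : ℕ), 1 ≤ n → ∀ (PM : Profile (Fin n) (Fin n)) (μ : Fin n ≃ Fin n),
        IsMRational PM μ.toPEquiv → DistinctTopChoices PM →
          (time n PM μ : ℝ) ≤ C * (n : ℝ) ^ 2) ∧
      -- average case
      (∀ (n : ℕ), 2 ≤ n → ∀ PM : Profile (Fin n) (Fin n),
        averageOverMatchings PM (time n PM) ≤ C * ((n : ℝ) ^ 2 * Real.log n))) := by
  constructor
  · intro W M _ _ _ PM μ hμ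
    have e : Fin (Fintype.card W) ≃ W := (Fintype.equivFin W).symm
    have hrat : IsMRational (fun v => (PM (μ (e v))).map e.symm)
        (Equiv.refl (Fin (Fintype.card W))).toPEquiv := by
      intro m w hw
      obtain rfl : m = w := by simpa using hw
      have h1 : e m ∉ (PM (μ (e m))).blacklist :=
        hμ (μ (e m)) (e m) (by simp [← Equiv.toPEquiv_symm])
      have h2 := PrefList.mem_blacklist_map e.symm (PM (μ (e m))) (e m)
      rw [e.symm_apply_apply] at h2
      exact fun hc => h1 (h2.1 hc)
    obtain ⟨-, -, PV, -, -, hPV, -⟩ := exec_algorithm _ _ _ hrat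
    exact ⟨_, hPV.rename e μ⟩
  · have hex : ∀ (n : ℕ) (PM : Profile (Fin n) (Fin n)) (μ : Fin n ≃ Fin n), ∃ t : ℕ,
        IsMRational PM μ.toPEquiv → (∃ (s : RAMState) (PW : Profile (Fin n) (Fin n)),
          algorithm.Exec (inputState n PM μ) t s ∧ IsOutput s PW ∧
            ForcesInconspicuously PM μ PW) ∧ t ≤ 150 * (n + 1) ^ 2 := by
      intro n PM μ
      by_cases h : IsMRational PM μ.toPEquiv
      · obtain ⟨t, s, PW, h1, h2, h3, h4⟩ := exec_algorithm n PM μ h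
        exact ⟨t, fun _ => ⟨⟨s, PW, h1, h2, h3⟩, h4⟩⟩
      · exact ⟨0, fun h' => absurd h' h⟩
    choose time htime using hex
    have hquad : ∀ (n : ℕ), 1 ≤ n → ∀ (PM : Profile (Fin n) (Fin n)) (μ : Fin n ≃ Fin n),
        IsMRational PM μ.toPEquiv → (time n PM μ : ℝ) ≤ 600 * (n : ℝ) ^ 2 := by
      intro n hn PM μ hμ
      have h1 : time n PM μ ≤ 600 * n ^ 2 := (htime n PM μ hμ).2.trans (by nlinarith)
      exact_mod_cast h1
    refine ⟨algorithm, time, 1200, fun n PM μ hμ => (htime n PM μ hμ).1, fun n hn PM μ hμ => ?_,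
      fun n hn PM μ hμ _ => ?_, fun n hn PM => ?_⟩
    -- the quadratic bound holds on every input, so it gives all three bounds
    · have hn' : (1 : ℝ) ≤ n := by exact_mod_cast hn
      refine (hquad n hn PM μ hμ).trans ?_
      have := pow_le_pow_right₀ hn' (show 2 ≤ 3 by norm_num)
      nlinarith [sq_nonneg (n : ℝ)]
    · refine (hquad n hn PM μ hμ).trans ?_
      nlinarith [sq_nonneg (n : ℝ)]
    · have hn' : (2 : ℝ) ≤ n := by exact_mod_cast hn
      have hlog : (1 / 2 : ℝ) ≤ Real.log n :=
        (by linarith [Real.log_two_gt_d9] : (1 / 2 : ℝ) ≤ Real.log 2).trans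
          (Real.log_le_log (by norm_num) hn')
      -- also if there is no rational perfect matching, when the mean is `0 / 0 = 0`
      have hsum : ∑ μ ∈ rationalPerfectMatchings PM, (time n PM μ : ℝ) ≤
          (rationalPerfectMatchings PM).card * (600 * (n : ℝ) ^ 2) := by
        rw [← nsmul_eq_mul]
        refine Finset.sum_le_card_nsmul _ _ _ fun μ hμ => ?_
        refine hquad n (by omega) PM μ ?_
        simpa [rationalPerfectMatchings] using hμ
      refine (div_le_of_le_mul₀ (Nat.cast_nonneg _) (by positivity)
        (hsum.trans_eq (mul_comm _ _))).trans ?_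
      nlinarith [mul_le_mul_of_nonneg_left hlog (sq_nonneg (n : ℝ))]
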